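/- Let $\mathcal S$ be a finite set of states and, for each $s\in\mathcal S$, let $\mathcal A(s)$ be a finite non-empty set of actions; write $\mathcal X=\{(s,a): s\in\mathcal S,\ a\in\mathcal A(s)\}$ for the set of pairs. A model $M$ is a Markov decision process on $\mathcal X$: playing a pair $x$ yields a reward with law $q_M(x)$ on $\mathbb R$ (with finite mean $r_M(x)$) and, independently, a next state with law $p_M(\cdot\mid x)$ on $\mathcal S$. It is communicating if every state can be reached from every state. For a deterministic stationary policy $\pi$ let $P_\pi$ and $r_\pi$ be its transition matrix and mean reward vector, $g_\pi=\lim_{n}\frac1n\sum_{t<n}P_\pi^t r_\pi$ its gain, and $h_\pi$ its bias, the Cesàro limit of $\sum_{t<n}P_\pi^t(r_\pi-g_\pi)$. Let $g^*(\cdot;M)=\max_\pi g_\pi$, let $\Pi^*(M)=\{\pi: g_\pi=g^*\}$ be the set of optimal policies, let $h^*=\max_{\pi\in\Pi^*(M)}h_\pi$, and let $\Delta^*(s,a)=g^*(s)+h^*(s)-r_M(s,a)-\sum_{s'}p_M(s'\mid s,a)h^*(s')$. The set $\mathcal X^{**}(M)$ of optimal pairs consists of the recurrent pairs of the randomized stationary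 policy that, in each state $s$, plays uniformly among the actions $a$ with $\Delta^*(s,a)=0$. Let $\mathcal M$ be a set of models on $\mathcal X$. The confusing set $\mathrm{Conf}(M)$ of $M\in\mathcal M$ is the set of all $M^\dagger\in\mathcal M$ such that (i) $p_M(\cdot\mid x)\ll p_{M^\dagger}(\cdot\mid x)$ and $q_M(x)\ll q_{M^\dagger}(x)$ for all $x\in\mathcal X$; (ii) $p_{M^\dagger}(\cdot\mid x)=p_M(\cdot\mid x)$ and $q_{M^\dagger}(x)=q_M(x)$ for all $x\in\mathcal X^{**}(M)$; (iii) $\Pi^*(M^\dagger)\cap\Pi^*(M)=\emptyset$. Put $\mathrm{KL}_x(M\|M^\dagger)=\mathrm{KL}(p_M(\cdot\mid x)\|p_{M^\dagger}(\cdot\mid x))+\mathrm{KL}(q_M(x)\|q_{M^\dagger}(x))\in[0,\infty]$. A learner $\Lambda$ chooses, at each time $t\ge1$ and possibly at random, an action available in the current state, as a function of the past pairs and rewards and of the current state. Write $\mathbb E^{M,\Lambda}_{s_0}$ for the expectation when $\Lambda$ plays in $M$ from the initial state $s_0$, $X_t$ and $R_t$ for the pair played and the reward received at time $t$, and $N_{T+1}(x)=\#\{1\le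 t\le T: X_t=x\}$. The learner is consistent (on $\mathcal M$) if, for every $M\in\mathcal M$, every $s_0\in\mathcal S$ and every $\eta>0$, $$T g^*(s_0;M)-\mathbb E^{M,\Lambda}_{s_0}\Big[\sum_{t=1}^T R_t\Big]=o(T^\eta)\qquad(T\to\infty).$$ Corollary. Let $M\in\mathcal M$ be communicating and let $M^\dagger\in\mathrm{Conf}(M)$. Then, for every initial state $s_0\in\mathcal S$, every consistent learner $\Lambda$ satisfies, as $T\to\infty$, $$\mathbb E^{M,\Lambda}_{s_0}\Big[\sum_{x\in\mathcal X}N_{T+1}(x)\,\mathrm{KL}_x(M\|M^\dagger)\Big]\ \ge\ \log T+o(\log T),$$ where the left-hand side may be $+\infty$. -/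

import Mathlib

open MeasureTheory ProbabilityTheory Filter Asymptotics
open scoped ENNReal Topology

noncomputable section

namespace MarkovDecision

/-- The finite set of state-action pairs `(s, a)` with `a ∈ A s`, as a discrete space. -/
def Pair {S : Type*} (A : S → Type*) : Type _ := Σ s : S, A s

namespace Pair

variable {S : Type*} {A : S → Type*}

/-- The pair `(s, a)`. -/
def mk (s : S) (a : A s) : Pair A := Sigma.mk s a

/-- The state in which the pair is rooted. -/
def state (x : Pair A) : S := Sigma.fst x

instance [Fintype S] [∀ s, Fintype (A s)] : Fintype (Pair A) :=
  inferInstanceAs (Fintype (Σ s : S, A s))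

instance : MeasurableSpace (Pair A) := ⊤

instance : DiscreteMeasurableSpace (Pair A) := ⟨fun _ => trivial⟩

end Pair

/-- A Markov decision process with states `S` and actions `A s` in state `s`: playing the pair `x`
yields a reward drawn from `reward x` and, independently, a next state drawn from `trans x`. -/
structure MDP {S : Type*} [MeasurableSpace S] (A : S → Type*) where
  trans : Pair A → Measure S
  reward : Pair A → Measure ℝ
  isProbabilityMeasure_trans : ∀ x, IsProbabilityMeasure (trans x)
  isProbabilityMeasure_reward : ∀ x, IsProbabilityMeasure (reward x)
  integrable_reward : ∀ x, Integrable (fun r : ℝ => r) (reward x)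

attribute [instance] MDP.isProbabilityMeasure_trans MDP.isProbabilityMeasure_reward

/-- What has been observed after `n` steps: the pairs played and the rewards received during these
steps, and the current state. -/
abbrev History {S : Type*} (A : S → Type*) (n : ℕ) : Type _ := (Fin n → Pair A × ℝ) × S

/-- A (possibly randomized) learner: given the history, it draws a pair rooted in the current
state. -/
structure Learner {S : Type*} [MeasurableSpace S] (A : S → Type*) where
  play : (n : ℕ) → Kernel (History A n) (Pair A)
  isMarkovKernel_play : ∀ n, IsMarkovKernel (play n)
  play_current : ∀ (n : ℕ) (h : History A n), ∀ᵐ x ∂(play n h), x.state = h.2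

attribute [instance] Learner.isMarkovKernel_play

/-- A stationary deterministic policy. -/
abbrev Policy {S : Type*} (A : S → Type*) : Type _ := (s : S) → A s

namespace MDP

variable {S : Type*} [MeasurableSpace S] {A : S → Type*}

/-! ### Gain, bias and optimal pairs -/

/-- The mean reward `r(x)` of a pair. -/
def meanReward (M : MDP A) (x : Pair A) : ℝ := ∫ r, r ∂(M.reward x)

/-- The transition operator `P_π` of a policy. -/
def transOp (M : MDP A) (π : Policy A) (v : S → ℝ) : S → ℝ :=
  fun s => ∫ s', v s' ∂(M.trans (Pair.mk s (π s)))

/-- The mean reward vector `r_π` of a policy. -/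
def policyReward (M : MDP A) (π : Policy A) : S → ℝ :=
  fun s => M.meanReward (Pair.mk s (π s))

/-- The gain `g_π(s) = lim (1/n) ∑_{t < n} (P_π^t r_π)(s)`
(for finitely many states the limit always exists, so it is the upper limit). -/
def gain (M : MDP A) (π : Policy A) (s : S) : ℝ :=
  limsup (fun n : ℕ =>
    (∑ t ∈ Finset.range n, (M.transOp π)^[t] (M.policyReward π) s) / (n : ℝ)) atTop

/-- The bias `h_π(s)`, the Cesàro limit of `∑_{t < k} (P_π^t (r_π - g_π))(s)` as `k → ∞`
(for finitely many states the limit always exists, so it is the upper limit). -/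
def bias (M : MDP A) (π : Policy A) (s : S) : ℝ :=
  limsup (fun n : ℕ =>
    (∑ k ∈ Finset.range n, ∑ t ∈ Finset.range k,
      (M.transOp π)^[t] (fun s' => M.policyReward π s' - M.gain π s') s) / (n : ℝ)) atTop

/-- The optimal gain `g*(s) = max_π g_π(s)`. -/
def optGain (M : MDP A) (s : S) : ℝ := ⨆ π : Policy A, M.gain π s

/-- The set of (gain) optimal policies. -/
def optPolicies (M : MDP A) : Set (Policy A) := {π | ∀ s, M.gain π s = M.optGain s}

/-- The optimal bias: the largest bias of an optimal policy. -/
def optBias (M : MDP A) (s : S) : ℝ := ⨆ π : M.optPolicies, M.bias π s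

/-- The gap `Δ*(s, a) = g*(s) + h*(s) - r(s, a) - ∑_{s'} p(s' | s, a) h*(s')`. -/
def gap (M : MDP A) (x : Pair A) : ℝ :=
  M.optGain x.state + M.optBias x.state - M.meanReward x - ∫ s', M.optBias s' ∂(M.trans x)

/-- The pairs with zero gap. -/
def weaklyOptimalPairs (M : MDP A) : Set (Pair A) := {x | M.gap x = 0}

/-- `M.Step W s s'`: playing some pair of `W` in state `s` leads to `s'` with positive probability.
Equivalently, the stationary randomized policy that plays uniformly among the actions `a` with
`(s, a) ∈ W` moves from `s` to `s'` with positive probability. -/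
def Step (M : MDP A) (W : Set (Pair A)) (s s' : S) : Prop :=
  ∃ a : A s, Pair.mk s a ∈ W ∧ 0 < M.trans (Pair.mk s a) {s'}

/-- `M.Reaches W s s'`: the state `s'` can be reached from `s` by playing pairs of `W`. -/
def Reaches (M : MDP A) (W : Set (Pair A)) : S → S → Prop := Relation.ReflTransGen (M.Step W)

/-- The recurrent pairs of the stationary randomized policy that plays uniformly among the actions
`a` with `(s, a) ∈ W`: those played in a state to which every state reachable from it leads back. -/
def recurrentPairs (M : MDP A) (W : Set (Pair A)) : Set (Pair A) :=
  {x | x ∈ W ∧ ∀ s', M.Reaches W x.state s' → M.Reaches W s' x.state}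

/-- The optimal pairs: the recurrent pairs of the policy that plays uniformly among the weakly
optimal actions. -/
def optimalPairs (M : MDP A) : Set (Pair A) := M.recurrentPairs M.weaklyOptimalPairs

/-- Every state can be reached from every state. -/
def IsCommunicating (M : MDP A) : Prop := ∀ s s', M.Reaches Set.univ s s'

/-! ### Confusing models -/

/-- `M† ≫ M`, for `N = M†`. -/
def Dominates (N M : MDP A) : Prop :=
  ∀ x, M.trans x ≪ N.trans x ∧ M.reward x ≪ N.reward x

/-- `M† = M` on a set of pairs, for `N = M†`. -/
def AgreesOn (N M : MDP A) (W : Set (Pair A)) : Prop :=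
  ∀ x ∈ W, N.trans x = M.trans x ∧ N.reward x = M.reward x

/-- The confusing set of `M` within the class `𝓜` of models. -/
def confusing (𝓜 : Set (MDP A)) (M : MDP A) : Set (MDP A) :=
  {N | N ∈ 𝓜 ∧ N.Dominates M ∧ N.AgreesOn M M.optimalPairs ∧ N.optPolicies ∩ M.optPolicies = ∅}

/-- `KL_x(M ‖ M†)`, the sum of the divergences of the transition and of the reward laws. -/
def kl (M N : MDP A) (x : Pair A) : ℝ≥0∞ :=
  InformationTheory.klDiv (M.trans x) (N.trans x) +
    InformationTheory.klDiv (M.reward x) (N.reward x)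

/-! ### The interaction of a learner with a model -/

variable [Fintype S] [∀ s, Fintype (A s)]

/-- The joint law of the reward and of the next state, given the pair that is played. -/
def response (M : MDP A) : Kernel (Pair A) (ℝ × S) where
  toFun x := (M.reward x).prod (M.trans x)
  measurable' := measurable_of_countable _

/-- The law under `P_{s₀}^{M, L}` of the history after `n` steps. -/
def historyLaw (M : MDP A) (L : Learner A) (s₀ : S) : (n : ℕ) → Measure (History A n)
  | 0 => Measure.dirac (Fin.elim0, s₀)
  | n + 1 =>
    (historyLaw M L s₀ n ⊗ₘ (L.play n ⊗ₖ M.response.prodMkLeft (History A n))).map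
      (fun z => (Fin.snoc z.1.1 (z.2.1, z.2.2.1), z.2.2.2))

/-- The expected regret `T g*(s₀) - E_{s₀}^{M, L}[∑_{t ≤ T} R_t]`. -/
def regret (M : MDP A) (L : Learner A) (s₀ : S) (T : ℕ) : ℝ :=
  (T : ℝ) * M.optGain s₀ - ∫ h, ∑ t : Fin T, (h.1 t).2 ∂(M.historyLaw L s₀ T)

end MDP

variable {S : Type*} {A : S → Type*}

open Classical in
/-- `N_{T+1}(x)`: how many times `x` has been played during the first `T` steps. -/
def visits {T : ℕ} (h : History A T) (x : Pair A) : ℕ :=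
  (Finset.univ.filter fun t : Fin T => (h.1 t).1 = x).card

/-- `L` is consistent on `𝓜`: for every model of `𝓜` and every initial state, the expected regret
is `o(T ^ η)` for all `η > 0`. -/
def Learner.IsConsistent [MeasurableSpace S] [Fintype S] [∀ s, Fintype (A s)]
    (L : Learner A) (𝓜 : Set (MDP A)) : Prop :=
  ∀ M ∈ 𝓜, ∀ s₀ : S, ∀ η : ℝ, 0 < η →
    (fun T : ℕ => M.regret L s₀ T) =o[atTop] (fun T : ℕ => (T : ℝ) ^ η)

end MarkovDecision

end

/-!
The proof is a change of measure between the laws of the history after `T` steps under `M` and under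
the confusing model `N`.

Both models are communicating, as `N` dominates `M`. In a communicating model the optimal gain is a
constant `g`, and there is a function `h` such that all gaps `g + h(s) - r(s, a) - p(s, a) h` are
nonnegative (`MDP.IsCommunicating.exists_bellman`). This is obtained from the linear program
`min g` subject to these inequalities: it has a solution by compactness, and its value is the gain of
some policy, because at a solution some set of states is closed under pairs with zero gap. Any such
`h` serves the purpose here; it need not be the optimal bias. For a learner with subpolynomial regret
the expected number of plays of pairs with positive gap is subpolynomial
(`MDP.eventually_integral_timeOutside_le`).

Let `Z` be the set of pairs whose gap is zero in both models and on which the transition laws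
agree. No set of states is closed under pairs of `Z`, since a policy that enters it and plays these
pairs there would be optimal in both models (`MDP.IsCommunicating.not_absorbing_of_disjoint`).
Consequently, there is a potential that decreases in mean whenever a pair of `Z` is played, and an
exponential supermartingale shows that a linear number of pairs outside of `Z` is played under `M`,
with probability tending to one (`MDP.exists_tendsto_timeOutside`). If the information, that is, the
expectation in the statement, is at most `log T`, then pairs on which the transition laws differ are
rarely played under `M`; so are pairs with positive gap in `M`. Hence a linear number of plays has
positive gap in `N`. Under `N` this event has probability `O(T ^ (η - 1))` for every `η > 0`.

The relative entropy of the two laws is at most the information (`MDP.klDiv_historyLaw_le`, by the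
chain rule), and an event whose probability is close to one under `M` and `O(T ^ (η - 1))` under `N`
forces it to be at least `(1 - δ) log T` (`ofReal_mul_log_le_klDiv`).
-/

set_option linter.unusedSectionVars false

namespace MarkovDecision

/-! ### Closed sets of states and potentials -/

theorem exists_pos_forall_le_of_ne_zero {ι : Type*} [Finite ι] (f : ι → ℝ) (hf : ∀ i, 0 ≤ f i) :
    ∃ p : ℝ, 0 < p ∧ ∀ i, f i ≠ 0 → p ≤ f i := by
  classical
  rcases isEmpty_or_nonempty ι with h | h
  · exact ⟨1, one_pos, fun i => (h.false i).elim⟩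
  obtain ⟨i₀, hi₀⟩ := Finite.exists_min fun i => if f i = 0 then 1 else f i
  refine ⟨if f i₀ = 0 then 1 else f i₀, ?_, fun i hi => ?_⟩
  · split_ifs with h0
    · exact one_pos
    · exact lt_of_le_of_ne (hf i₀) (Ne.symm h0)
  · simpa [hi] using hi₀ i

theorem exists_forall_abs_le {ι : Type*} [Finite ι] (f : ι → ℝ) :
    ∃ C : ℝ, 0 ≤ C ∧ ∀ i, |f i| ≤ C := by
  cases nonempty_fintype ι
  exact ⟨∑ i, |f i|, Finset.sum_nonneg fun i _ => abs_nonneg _, fun i =>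
    Finset.single_le_sum (f := fun i => |f i|) (fun i _ => abs_nonneg _) (Finset.mem_univ i)⟩

theorem exists_dist_of_reflTransGen {S : Type*} (r : S → S → Prop) (U : Set S)
    (hr : ∀ s, ∃ u ∈ U, Relation.ReflTransGen r s u) :
    ∃ d : S → ℕ, ∀ s ∉ U, ∃ s', r s s' ∧ d s' < d s := by
  classical
  let P : ℕ → S → Prop := fun n => Nat.rec (fun s => s ∈ U) (fun _ Q s => ∃ s', r s s' ∧ Q s') n
  have hex (s : S) : ∃ n, P n s := by
    obtain ⟨u, hu, hsu⟩ := hr s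
    induction hsu using Relation.ReflTransGen.head_induction_on with
    | refl => exact ⟨0, hu⟩
    | head hac _ ih => exact ih.elim fun n hn => ⟨n + 1, _, hac, hn⟩
  have hspec (s : S) : P (sInf {n | P n s}) s := Nat.sInf_mem (hex s)
  refine ⟨fun s => sInf {n | P n s}, fun s hs => ?_⟩
  obtain ⟨k, hk⟩ : ∃ k, sInf {n | P n s} = k + 1 := by
    refine Nat.exists_eq_succ_of_ne_zero fun h => ?_
    exact hs (h ▸ hspec s : P 0 s)
  obtain ⟨s', hss', hs'⟩ : P (k + 1) s := hk ▸ hspec s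
  refine ⟨s', hss', ?_⟩
  have : sInf {n | P n s'} ≤ k := Nat.sInf_le hs'
  exact (Nat.lt_succ_of_le this).trans_eq hk.symm

namespace MDP

variable {S : Type*} [Fintype S] [MeasurableSpace S] [DiscreteMeasurableSpace S]
  {A : S → Type*} [∀ s, Fintype (A s)]

/-- The set `U` of states is closed under some choice of pairs of `Z`: in each state of `U` there is
a pair of `Z` from which the next state is almost surely in `U`. -/
def Absorbing (M : MDP A) (Z : Set (Pair A)) (U : Set S) : Prop :=
  ∀ s ∈ U, ∃ a : A s, Pair.mk s a ∈ Z ∧ M.trans (Pair.mk s a) Uᶜ = 0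

/-- The ranks come from peeling off states: `U 0 = univ`, and `U (k + 1)` keeps the states in which
some pair of `Z` stays in `U k`; the limit of this sequence is absorbing, hence empty. -/
theorem exists_rank_of_not_absorbing (M : MDP A) (Z : Set (Pair A))
    (hZ : ∀ U : Set S, U.Nonempty → ¬ M.Absorbing Z U) :
    ∃ d : S → ℕ, ∀ x ∈ Z, M.trans x {s' | d s' < d x.state} ≠ 0 := by
  classical
  let U : ℕ → Set S := fun n => Nat.rec Set.univ
    (fun _ V => {s | ∃ a : A s, Pair.mk s a ∈ Z ∧ M.trans (Pair.mk s a) Vᶜ = 0}) n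
  have hU (n : ℕ) : U (n + 1) = {s | ∃ a : A s, Pair.mk s a ∈ Z ∧
      M.trans (Pair.mk s a) (U n)ᶜ = 0} := rfl
  have hanti : Antitone U := by
    refine antitone_nat_of_succ_le fun n => ?_
    induction n with
    | zero => exact Set.subset_univ _
    | succ n ih =>
      rintro s ⟨a, ha, h0⟩
      exact ⟨a, ha, measure_mono_null (Set.compl_subset_compl.2 ih) h0⟩
  obtain ⟨n, hn⟩ := WellFoundedLT.antitone_chain_condition hanti
  have hempty : U n = ∅ := by
    by_contra hne
    refine hZ (U n) (Set.nonempty_iff_ne_empty.2 hne) fun s hs => ?_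
    rw [hn (n + 1) n.le_succ, hU] at hs
    exact hs
  have hex (s : S) : ∃ k, s ∉ U k := ⟨n, by simp [hempty]⟩
  have hspec (s : S) : s ∉ U (sInf {k | s ∉ U k}) := Nat.sInf_mem (s := {k | s ∉ U k}) (hex s)
  refine ⟨fun s => sInf {k | s ∉ U k}, fun x hx h0 => ?_⟩
  obtain ⟨k, hk⟩ : ∃ k, sInf {k | x.state ∉ U k} = k + 1 := by
    refine Nat.exists_eq_succ_of_ne_zero fun h => ?_
    exact (h ▸ hspec x.state : x.state ∉ U 0) (Set.mem_univ _)
  have hx' : x.state ∉ U (k + 1) := hk ▸ hspec x.state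
  refine hx' ⟨Sigma.snd x, hx, measure_mono_null (fun s' hs' => ?_) h0⟩
  have : sInf {k | s' ∉ U k} ≤ k := Nat.sInf_le hs'
  exact (Nat.lt_succ_of_le this).trans_eq hk.symm

/-- If no nonempty set of states is closed under a choice of pairs of `Z`, then playing pairs of `Z`
uses up a bounded potential at unit speed. -/
theorem exists_potential_of_not_absorbing (M : MDP A) (Z : Set (Pair A))
    (hZ : ∀ U : Set S, U.Nonempty → ¬ M.Absorbing Z U) :
    ∃ V : S → ℝ, (∀ s, 1 ≤ V s) ∧ ∀ x ∈ Z, ∫ s', V s' ∂(M.trans x) + 1 ≤ V x.state := by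
  classical
  obtain ⟨d, hd⟩ := M.exists_rank_of_not_absorbing Z hZ
  obtain ⟨p, hp, hple⟩ := exists_pos_forall_le_of_ne_zero
    (fun z : Pair A × Set S => (M.trans z.1).real z.2) fun _ => measureReal_nonneg
  obtain ⟨K, hK⟩ : ∃ K, ∀ s, d s ≤ K :=
    ⟨∑ s, d s, fun s => Finset.single_le_sum (fun _ _ => Nat.zero_le _) (Finset.mem_univ s)⟩
  -- A lower rank weighs at least `q` times more, and is reached with probability at least `p`.
  set q : ℝ := 2 / min p 1 with hq
  have hm : 0 < min p 1 := lt_min hp one_pos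
  have hq1 : 1 ≤ q := by
    rw [hq, le_div_iff₀ hm]; linarith [min_le_right p 1]
  have hpq : 2 ≤ p * q := by
    rw [hq, mul_div_assoc', le_div_iff₀ hm]; nlinarith [min_le_left p 1]
  have hw1 (s : S) : 1 ≤ q ^ (K - d s) := one_le_pow₀ hq1
  refine ⟨fun s => 1 + q ^ K - q ^ (K - d s), fun s => ?_, fun x hx => ?_⟩
  · have : q ^ (K - d s) ≤ q ^ K := pow_le_pow_right₀ hq1 (Nat.sub_le _ _)
    linarith
  set B : Set S := {s' | d s' < d x.state} with hB
  have hpB : p ≤ (M.trans x).real B := hple (x, B) (by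
    simpa [measureReal_def, ENNReal.toReal_eq_zero_iff] using hd x hx)
  have hint : p * (q * q ^ (K - d x.state)) ≤ ∫ s', q ^ (K - d s') ∂(M.trans x) := by
    calc p * (q * q ^ (K - d x.state))
        ≤ (M.trans x).real B * (q * q ^ (K - d x.state)) := by gcongr
      _ = ∫ s', B.indicator (fun _ => q * q ^ (K - d x.state)) s' ∂(M.trans x) := by
          rw [integral_indicator_const _ (MeasurableSet.of_discrete), smul_eq_mul]
      _ ≤ _ := by
          refine integral_mono Integrable.of_finite Integrable.of_finite fun s' => ?_
          by_cases hs' : s' ∈ B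
          · have h1 : d s' < d x.state := hs'
            have h2 := hK x.state
            simp only [Set.indicator_of_mem hs']
            rw [← pow_succ']
            exact pow_le_pow_right₀ hq1 (by omega)
          · simp only [Set.indicator_of_notMem hs']
            linarith [hw1 s']
  have h2 : 2 * q ^ (K - d x.state) ≤ p * (q * q ^ (K - d x.state)) := by
    rw [← mul_assoc]; gcongr
  rw [integral_sub Integrable.of_finite Integrable.of_finite]
  simp only [integral_const, probReal_univ, one_smul]
  linarith [hw1 x.state]

/-! ### Gains and Bellman certificates -/

/-- The gap `g + h(s) - r(s, a) - ∑_{s'} p(s' | s, a) h(s')` of a pair in the Bellman inequality, for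
a constant gain `g` and an arbitrary function `h` in place of the bias. -/
noncomputable def bellmanGap (M : MDP A) (g : ℝ) (h : S → ℝ) (x : Pair A) : ℝ :=
  g + h x.state - M.meanReward x - ∫ s', h s' ∂(M.trans x)

theorem transOp_mono (M : MDP A) (π : Policy A) : Monotone (M.transOp π) := fun _ _ hvw _ =>
  integral_mono Integrable.of_finite Integrable.of_finite hvw

theorem transOp_iterate_affine (M : MDP A) (π : Policy A) (g : ℝ) (v w : S → ℝ) (n : ℕ) (s : S) :
    (M.transOp π)^[n] (fun s => g + v s - w s) s =
      g + (M.transOp π)^[n] v s - (M.transOp π)^[n] w s := by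
  induction n generalizing v w s with
  | zero => rfl
  | succ n ih =>
    simp only [Function.iterate_succ, Function.comp_apply]
    rw [← ih]
    refine congrArg (fun u => (M.transOp π)^[n] u s) (funext fun s => ?_)
    simp only [transOp]
    rw [integral_sub Integrable.of_finite Integrable.of_finite,
      integral_add Integrable.of_finite Integrable.of_finite]
    simp

theorem sum_transOp_iterate_affine (M : MDP A) (π : Policy A) (g : ℝ) (w : S → ℝ) (n : ℕ) (s : S) :
    ∑ t ∈ Finset.range n, (M.transOp π)^[t] (fun s => g + w s - M.transOp π w s) s =
      n * g + w s - (M.transOp π)^[n] w s := by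
  induction n with
  | zero => simp
  | succ n ih =>
    rw [Finset.sum_range_succ, ih, transOp_iterate_affine, Function.iterate_succ_apply]
    push_cast
    ring

theorem abs_transOp_iterate_le (M : MDP A) (π : Policy A) {C : ℝ} (v : S → ℝ)
    (hv : ∀ s, |v s| ≤ C) (n : ℕ) (s : S) : |(M.transOp π)^[n] v s| ≤ C := by
  induction n generalizing v with
  | zero => exact hv s
  | succ n ih =>
    refine ih _ fun s => ?_
    have := norm_integral_le_of_norm_le_const (μ := M.trans (Pair.mk s (π s)))
      (Eventually.of_forall fun s' => (Real.norm_eq_abs (v s')).trans_le (hv s'))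
    simpa [transOp] using this

theorem tendsto_affine_average (g C : ℝ) :
    Tendsto (fun n : ℕ => g + C / (n : ℝ)) atTop (𝓝 g) := by
  simpa using tendsto_const_nhds.add (tendsto_const_div_atTop_nhds_zero_nat C)

theorem abs_average_reward_le (M : MDP A) (π : Policy A) (s : S) :
    ∃ C : ℝ, ∀ n : ℕ,
      |(∑ t ∈ Finset.range n, (M.transOp π)^[t] (M.policyReward π) s) / (n : ℝ)| ≤ C := by
  obtain ⟨C, hC0, hC⟩ := exists_forall_abs_le (M.policyReward π)
  refine ⟨C, fun n => ?_⟩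
  rw [abs_div, Nat.abs_cast]
  refine div_le_of_le_mul₀ n.cast_nonneg hC0 ?_
  calc _ ≤ ∑ t ∈ Finset.range n, |(M.transOp π)^[t] (M.policyReward π) s| :=
        Finset.abs_sum_le_sum_abs _ _
    _ ≤ ∑ t ∈ Finset.range n, C :=
        Finset.sum_le_sum fun t _ => M.abs_transOp_iterate_le π _ hC t s
    _ = C * n := by simp [mul_comm]

/-- Bounds on the reward of the form `g + w - P w` telescope in the averages that define the gain. -/
theorem gain_le (M : MDP A) (π : Policy A) (g : ℝ) (w : S → ℝ)
    (h : ∀ s, M.policyReward π s ≤ g + w s - M.transOp π w s) (s : S) : M.gain π s ≤ g := by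
  obtain ⟨B, hB0, hB⟩ := exists_forall_abs_le w
  obtain ⟨C, hC⟩ := M.abs_average_reward_le π s
  have hle : ∀ᶠ n : ℕ in atTop,
      (∑ t ∈ Finset.range n, (M.transOp π)^[t] (M.policyReward π) s) / (n : ℝ) ≤
        g + (2 * B) / n := by
    filter_upwards [eventually_gt_atTop 0] with n hn
    have hn' : (0 : ℝ) < n := Nat.cast_pos.2 hn
    have h1 : ∑ t ∈ Finset.range n, (M.transOp π)^[t] (M.policyReward π) s ≤
        n * g + w s - (M.transOp π)^[n] w s := by
      rw [← sum_transOp_iterate_affine]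
      exact Finset.sum_le_sum fun t _ => (M.transOp_mono π).iterate t h s
    have h2 := abs_le.1 (hB s)
    have h3 := abs_le.1 (M.abs_transOp_iterate_le π w hB n s)
    rw [div_le_iff₀ hn', add_mul, div_mul_cancel₀ _ hn'.ne']
    linarith
  calc M.gain π s ≤ limsup (fun n : ℕ => g + (2 * B) / (n : ℝ)) atTop :=
        limsup_le_limsup hle
          (IsBoundedUnder.isCoboundedUnder_le ⟨-C, by
            simpa using ⟨0, fun n _ => (abs_le.1 (hC n)).1⟩⟩)
          (tendsto_affine_average g _).isBoundedUnder_le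
    _ = g := (tendsto_affine_average g _).limsup_eq

theorem le_gain (M : MDP A) (π : Policy A) (g : ℝ) (w : S → ℝ)
    (h : ∀ s, g + w s - M.transOp π w s ≤ M.policyReward π s) (s : S) : g ≤ M.gain π s := by
  obtain ⟨B, hB0, hB⟩ := exists_forall_abs_le w
  obtain ⟨C, hC⟩ := M.abs_average_reward_le π s
  have hle : ∀ᶠ n : ℕ in atTop, g + (-(2 * B)) / n ≤
      (∑ t ∈ Finset.range n, (M.transOp π)^[t] (M.policyReward π) s) / (n : ℝ) := by
    filter_upwards [eventually_gt_atTop 0] with n hn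
    have hn' : (0 : ℝ) < n := Nat.cast_pos.2 hn
    have h1 : n * g + w s - (M.transOp π)^[n] w s ≤
        ∑ t ∈ Finset.range n, (M.transOp π)^[t] (M.policyReward π) s := by
      rw [← sum_transOp_iterate_affine]
      exact Finset.sum_le_sum fun t _ => (M.transOp_mono π).iterate t h s
    have h2 := abs_le.1 (hB s)
    have h3 := abs_le.1 (M.abs_transOp_iterate_le π w hB n s)
    rw [le_div_iff₀ hn', add_mul, div_mul_cancel₀ _ hn'.ne']
    linarith
  calc g = limsup (fun n : ℕ => g + (-(2 * B)) / (n : ℝ)) atTop :=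
        ((tendsto_affine_average g _).limsup_eq).symm
    _ ≤ M.gain π s :=
        limsup_le_limsup hle (tendsto_affine_average g _).isBoundedUnder_ge.isCoboundedUnder_le
          ⟨C, by simpa using ⟨0, fun n _ => (abs_le.1 (hC n)).2⟩⟩

theorem gain_le_of_bellmanGap_nonneg (M : MDP A) (g : ℝ) (h : S → ℝ)
    (hgap : ∀ x, 0 ≤ M.bellmanGap g h x) (π : Policy A) (s : S) : M.gain π s ≤ g := by
  refine M.gain_le π g h (fun s => ?_) s
  have := hgap (Pair.mk s (π s))
  simp only [bellmanGap, Pair.state, Pair.mk, policyReward, transOp] at this ⊢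
  linarith

/-- Outside of the closed set `U` the gaps are paid for by the potential of the time spent there,
which is finite because the policy almost surely enters `U`. -/
theorem gain_eq_of_absorbing (M : MDP A) (g : ℝ) (h : S → ℝ)
    (hgap : ∀ x, 0 ≤ M.bellmanGap g h x) (π : Policy A) (U : Set S)
    (hU : ∀ s ∈ U, M.bellmanGap g h (Pair.mk s (π s)) = 0 ∧ M.trans (Pair.mk s (π s)) Uᶜ = 0)
    (hout : ∀ U' : Set S, U'.Nonempty →
      ¬ M.Absorbing {x | ∃ s ∉ U, x = Pair.mk s (π s)} U') (s : S) :
    M.gain π s = g := by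
  classical
  refine le_antisymm (M.gain_le_of_bellmanGap_nonneg g h hgap π s) ?_
  obtain ⟨V, hV1, hV⟩ := M.exists_potential_of_not_absorbing _ hout
  obtain ⟨C, hC0, hC⟩ := exists_forall_abs_le (M.bellmanGap g h)
  have hint (s : S) (v w : S → ℝ) :
      ∫ s', (v s' - C * w s') ∂(M.trans (Pair.mk s (π s))) =
      ∫ s', v s' ∂(M.trans (Pair.mk s (π s))) - C * ∫ s', w s' ∂(M.trans (Pair.mk s (π s))) := by
    rw [integral_sub Integrable.of_finite Integrable.of_finite, integral_const_mul]
  refine M.le_gain π g (fun s => h s - C * Uᶜ.indicator V s) (fun s => ?_) s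
  simp only [transOp, policyReward, hint]
  by_cases hs : s ∈ U
  · have h0 : ∫ s', Uᶜ.indicator V s' ∂(M.trans (Pair.mk s (π s))) = 0 := by
      rw [integral_indicator MeasurableSet.of_discrete,
        Measure.restrict_eq_zero.2 (hU s hs).2, integral_zero_measure]
    have h1 := (hU s hs).1
    simp only [bellmanGap, Pair.state, Pair.mk] at h1
    have h2 : Uᶜ.indicator V s = 0 := by simp [hs]
    rw [h0, h2]
    simp only [Pair.mk]
    linarith
  · have h1 : ∫ s', Uᶜ.indicator V s' ∂(M.trans (Pair.mk s (π s))) + 1 ≤ V s := by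
      refine le_trans ?_ (hV (Pair.mk s (π s)) ⟨s, hs, rfl⟩)
      gcongr
      · exact Integrable.of_finite
      · exact Integrable.of_finite
      · exact fun s' => Set.indicator_le_self' (fun _ _ => zero_le_one.trans (hV1 _)) s'
    have h2 : Uᶜ.indicator V s = V s := by simp [hs]
    have h3 := (abs_le.1 (hC (Pair.mk s (π s)))).2
    simp only [bellmanGap, Pair.state, Pair.mk] at h3
    rw [h2]
    simp only [Pair.mk] at h1 ⊢
    nlinarith

/-! ### The optimality equation of communicating models -/

theorem IsCommunicating.of_dominates {M N : MDP A} (hM : M.IsCommunicating)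
    (hN : N.Dominates M) : N.IsCommunicating := fun s s' =>
  Relation.ReflTransGen.mono (fun s _ ⟨a, ha, hpos⟩ => ⟨a, ha, pos_iff_ne_zero.2 fun h0 =>
    hpos.ne' ((hN (Pair.mk s a)).1 h0)⟩) _ _ (hM s s')

/-- In a communicating model, a choice of pairs under which a set of states is closed extends to a
policy that almost surely enters this set, also in every dominating model. -/
theorem IsCommunicating.exists_policy {M : MDP A} (hM : M.IsCommunicating) {Z : Set (Pair A)}
    {U : Set S} (hne : U.Nonempty) (hU : M.Absorbing Z U) :
    ∃ π : Policy A,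
      (∀ s ∈ U, Pair.mk s (π s) ∈ Z ∧ M.trans (Pair.mk s (π s)) Uᶜ = 0) ∧
      ∀ N : MDP A, N.Dominates M → ∀ U' : Set S, U'.Nonempty →
        ¬ N.Absorbing {x | ∃ s ∉ U, x = Pair.mk s (π s)} U' := by
  classical
  obtain ⟨u, hu⟩ := hne
  obtain ⟨d, hd⟩ := exists_dist_of_reflTransGen (M.Step Set.univ) U fun s => ⟨u, hu, hM s u⟩
  have hex (s : S) : ∃ a : A s,
      (s ∈ U → Pair.mk s a ∈ Z ∧ M.trans (Pair.mk s a) Uᶜ = 0) ∧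
      (s ∉ U → ∃ s', 0 < M.trans (Pair.mk s a) {s'} ∧ d s' < d s) := by
    by_cases hs : s ∈ U
    · obtain ⟨a, ha⟩ := hU s hs
      exact ⟨a, fun _ => ha, fun h => (h hs).elim⟩
    · obtain ⟨s', ⟨a, -, ha⟩, hs'⟩ := hd s hs
      exact ⟨a, fun h => (hs h).elim, fun _ => ⟨s', ha, hs'⟩⟩
  choose π hπU hπ using hex
  refine ⟨π, hπU, fun N hN U' hne' habs => ?_⟩
  -- A state of `U'` closest to `U` could step closer still, hence out of `U'`.
  obtain ⟨s, hs, hmin⟩ := Set.exists_min_image U' d (Set.toFinite _) hne'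
  obtain ⟨a, ⟨s₁, hs₁, heq⟩, h0⟩ := habs s hs
  obtain rfl : s = s₁ := congrArg Sigma.fst heq
  obtain ⟨s', hpos, hlt⟩ := hπ s hs₁
  rw [heq] at h0
  have hs' : s' ∉ U' := fun h => (hmin s' h).not_gt hlt
  refine hpos.ne' ((hN _).1 (measure_mono_null ?_ h0))
  simpa using hs'

theorem Dominates.refl (M : MDP A) : M.Dominates M := fun _ =>
  ⟨Measure.AbsolutelyContinuous.rfl, Measure.AbsolutelyContinuous.rfl⟩

theorem bellmanGap_sub_const (M : MDP A) (g c : ℝ) (h : S → ℝ) (x : Pair A) :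
    M.bellmanGap g (fun s => h s - c) x = M.bellmanGap g h x := by
  simp only [bellmanGap]
  rw [integral_sub Integrable.of_finite Integrable.of_finite]
  simp only [integral_const, probReal_univ, one_smul]
  ring

theorem continuous_bellmanGap (M : MDP A) (x : Pair A) :
    Continuous fun z : ℝ × (S → ℝ) => M.bellmanGap z.1 z.2 x := by
  have : ∀ v : S → ℝ, ∫ s', v s' ∂(M.trans x) = ∑ s', (M.trans x).real {s'} • v s' := fun v =>
    integral_fintype Integrable.of_finite
  simp only [bellmanGap, this]
  fun_prop

/-- A Harnack inequality for nonnegative functions satisfying the Bellman inequality. -/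
theorem exists_bound_of_reaches (M : MDP A) {R : ℝ} (hR : ∀ x, |M.meanReward x| ≤ R) {s s' : S}
    (hs : M.Reaches Set.univ s s') :
    ∃ C : ℝ, 0 ≤ C ∧ ∀ (g : ℝ) (h : S → ℝ), g ≤ R → (∀ s, 0 ≤ h s) →
      (∀ x, 0 ≤ M.bellmanGap g h x) → h s' ≤ C * (h s + 1) := by
  induction hs with
  | refl => exact ⟨1, zero_le_one, fun g h _ _ _ => by linarith⟩
  | @tail s₁ s₂ _ hstep ih =>
    obtain ⟨C, hC0, hC⟩ := ih
    obtain ⟨a, -, hpos⟩ := hstep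
    set x := Pair.mk s₁ a with hx
    have hp : 0 < (M.trans x).real {s₂} := ENNReal.toReal_pos hpos.ne' (measure_ne_top _ _)
    have hR0 : 0 ≤ R := (abs_nonneg _).trans (hR x)
    refine ⟨(2 * R + C) / (M.trans x).real {s₂}, by positivity, fun g h hg h0 hgap => ?_⟩
    have h1 := hC g h hg h0 hgap
    have h2 : 0 ≤ g + h s₁ - M.meanReward x - ∫ s', h s' ∂(M.trans x) := hgap x
    have h3 := (abs_le.1 (hR x)).1
    have h4 : (M.trans x).real {s₂} * h s₂ ≤ ∫ s', h s' ∂(M.trans x) := by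
      rw [integral_fintype Integrable.of_finite]
      exact Finset.single_le_sum (f := fun s' => (M.trans x).real {s'} • h s')
        (fun s' _ => mul_nonneg measureReal_nonneg (h0 s')) (Finset.mem_univ s₂)
    rw [div_mul_eq_mul_div, le_div_iff₀ hp]
    nlinarith [h0 s, mul_nonneg hR0 (h0 s)]

/-- The linear program `min g` subject to the Bellman inequalities `g + h ≥ r + P h` has a solution
in a communicating model. -/
theorem IsCommunicating.exists_minimal_bellman [Nonempty S] [∀ s, Nonempty (A s)] {M : MDP A}
    (hM : M.IsCommunicating) :
    ∃ (g : ℝ) (h : S → ℝ), (∀ x, 0 ≤ M.bellmanGap g h x) ∧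
      ∀ (g' : ℝ) (h' : S → ℝ), (∀ x, 0 ≤ M.bellmanGap g' h' x) → g ≤ g' := by
  classical
  obtain ⟨R, hR0, hR⟩ := exists_forall_abs_le M.meanReward
  choose C hC0 hC using fun s s' => M.exists_bound_of_reaches hR (hM s s')
  obtain ⟨D, hD0, hD⟩ := exists_forall_abs_le fun z : S × S => C z.1 z.2
  let K : Set (ℝ × (S → ℝ)) := {z | (∀ x, 0 ≤ M.bellmanGap z.1 z.2 x) ∧ z.1 ≤ R ∧
    (∀ s, 0 ≤ z.2 s) ∧ ∃ s, z.2 s = 0}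
  have hKcl : IsClosed K := by
    have h1 : IsClosed {z : ℝ × (S → ℝ) | ∀ x, 0 ≤ M.bellmanGap z.1 z.2 x} := by
      simp only [Set.ofPred_forall]
      exact isClosed_iInter fun x => isClosed_le continuous_const (M.continuous_bellmanGap x)
    have h2 : IsClosed {z : ℝ × (S → ℝ) | z.1 ≤ R} := isClosed_le continuous_fst continuous_const
    have h3 : IsClosed {z : ℝ × (S → ℝ) | ∀ s, 0 ≤ z.2 s} := by
      simp only [Set.ofPred_forall]
      exact isClosed_iInter fun s => isClosed_le continuous_const (by fun_prop)
    have h4 : IsClosed {z : ℝ × (S → ℝ) | ∃ s, z.2 s = 0} := by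
      simp only [Set.ofPred_exists]
      exact isClosed_iUnion_of_finite fun s => isClosed_eq (by fun_prop) continuous_const
    exact h1.inter (h2.inter (h3.inter h4))
  have hKsub : K ⊆ Set.Icc (-R) R ×ˢ Set.univ.pi fun _ : S => Set.Icc 0 D := by
    rintro ⟨g, h⟩ ⟨hgap, hg, h0, s, hs⟩
    dsimp only at hgap hg h0 hs
    refine ⟨⟨?_, hg⟩, fun s' _ => ⟨h0 s', ?_⟩⟩
    · have h1 : 0 ≤ g + h s - M.meanReward (Pair.mk s (Classical.arbitrary _)) -
          ∫ s', h s' ∂(M.trans (Pair.mk s (Classical.arbitrary _))) :=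
        hgap (Pair.mk s (Classical.arbitrary _))
      have h2 := (abs_le.1 (hR (Pair.mk s (Classical.arbitrary _)))).1
      have h3 : 0 ≤ ∫ s', h s' ∂(M.trans (Pair.mk s (Classical.arbitrary _))) :=
        integral_nonneg h0
      dsimp only
      linarith
    · have h1 := hC s s' g h hg h0 hgap
      have h2 := (le_abs_self _).trans (hD (s, s'))
      simp only [hs] at h1 h2
      dsimp only
      linarith
  have hKcomp : IsCompact K :=
    (isCompact_Icc.prod (isCompact_univ_pi fun _ => isCompact_Icc)).of_isClosed_subset hKcl hKsub
  have hKmem (g : ℝ) (hg : g ≤ R) (h : S → ℝ) (hgap : ∀ x, 0 ≤ M.bellmanGap g h x) :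
      ∃ z ∈ K, z.1 = g := by
    obtain ⟨s₀, hs₀⟩ := Finite.exists_min h
    refine ⟨(g, fun s => h s - h s₀), ⟨fun x => ?_, hg, fun s => sub_nonneg.2 (hs₀ s), s₀, ?_⟩,
      rfl⟩
    · simpa only [bellmanGap_sub_const] using hgap x
    · simp
  obtain ⟨z₀, hz₀, -⟩ := hKmem R le_rfl (fun _ => 0) fun x => by
    have := (abs_le.1 (hR x)).2
    simp only [bellmanGap, integral_zero]
    linarith
  obtain ⟨z, hz, hmin⟩ := hKcomp.exists_isMinOn ⟨z₀, hz₀⟩ continuous_fst.continuousOn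
  refine ⟨z.1, z.2, hz.1, fun g' h' hgap' => ?_⟩
  rcases le_total g' R with hg' | hg'
  · obtain ⟨z', hz', rfl⟩ := hKmem g' hg' h' hgap'
    exact hmin hz'
  · exact hz.2.1.trans hg'

/-- At a minimal solution some set of states is closed under pairs with zero gap: otherwise a small
multiple of a potential, added to `h`, makes all gaps positive, and `g` can be lowered. -/
theorem exists_absorbing_of_minimal (M : MDP A) (g : ℝ)
    (h : S → ℝ)
    (hgap : ∀ x, 0 ≤ M.bellmanGap g h x)
    (hmin : ∀ (g' : ℝ) (h' : S → ℝ), (∀ x, 0 ≤ M.bellmanGap g' h' x) → g ≤ g') :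
    ∃ U : Set S, U.Nonempty ∧ M.Absorbing {x | M.bellmanGap g h x = 0} U := by
  by_contra! hno
  obtain ⟨V, hV1, hV⟩ := M.exists_potential_of_not_absorbing _ hno
  obtain ⟨δ, hδ, hδle⟩ := exists_pos_forall_le_of_ne_zero _ hgap
  obtain ⟨C, hC0, hC⟩ := exists_forall_abs_le fun x => V x.state - ∫ s', V s' ∂(M.trans x)
  set ε : ℝ := δ / (2 * (C + 1)) with hε
  have hε0 : 0 < ε := by positivity
  have hεC : ε * C ≤ δ / 2 := by
    rw [hε, div_mul_eq_mul_div, div_le_div_iff₀ (by positivity) two_pos]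
    nlinarith
  have key (x : Pair A) : M.bellmanGap (g - min ε (δ / 2)) (fun s => h s + ε * V s) x =
      M.bellmanGap g h x + ε * (V x.state - ∫ s', V s' ∂(M.trans x)) - min ε (δ / 2) := by
    simp only [bellmanGap]
    rw [integral_add Integrable.of_finite Integrable.of_finite, integral_const_mul]
    ring
  have hlow := hmin (g - min ε (δ / 2)) (fun s => h s + ε * V s) fun x => by
    rw [key]
    by_cases hx : M.bellmanGap g h x = 0
    · have := hV x hx
      nlinarith [min_le_left ε (δ / 2)]
    · have h1 := hδle x hx
      have h2 := (abs_le.1 (hC x)).1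
      nlinarith [min_le_right ε (δ / 2)]
  have : 0 < min ε (δ / 2) := lt_min hε0 (half_pos hδ)
  linarith

/-- The optimality equation of a communicating model, as an inequality. -/
theorem IsCommunicating.exists_bellman [Nonempty S] [∀ s, Nonempty (A s)] {M : MDP A}
    (hM : M.IsCommunicating) :
    ∃ (g : ℝ) (h : S → ℝ), (∀ s, M.optGain s = g) ∧ ∀ x, 0 ≤ M.bellmanGap g h x := by
  classical
  obtain ⟨g, h, hgap, hmin⟩ := hM.exists_minimal_bellman
  refine ⟨g, h, fun s => ?_, hgap⟩
  obtain ⟨U, hne, hU⟩ := M.exists_absorbing_of_minimal g h hgap hmin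
  obtain ⟨π, hπ, hout⟩ := hM.exists_policy hne hU
  have hπg := M.gain_eq_of_absorbing g h hgap π U hπ (hout M (Dominates.refl M)) s
  have hle (π' : Policy A) : M.gain π' s ≤ g := M.gain_le_of_bellmanGap_nonneg g h hgap π' s
  exact le_antisymm (ciSup_le hle) (hπg ▸ le_ciSup ⟨g, Set.forall_mem_range.2 hle⟩ π)

/-- Two models without common optimal policy cannot have a set of states that is closed under pairs
on which the transition laws agree and whose gap is zero in both models. -/
theorem IsCommunicating.not_absorbing_of_disjoint {M N : MDP A}
    (hM : M.IsCommunicating) (hN : N.Dominates M) (hdisj : N.optPolicies ∩ M.optPolicies = ∅)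
    {g g' : ℝ} {h h' : S → ℝ} (hg : ∀ s, M.optGain s = g) (hg' : ∀ s, N.optGain s = g')
    (hgap : ∀ x, 0 ≤ M.bellmanGap g h x) (hgap' : ∀ x, 0 ≤ N.bellmanGap g' h' x)
    {U : Set S} (hne : U.Nonempty) :
    ¬ M.Absorbing {x | M.bellmanGap g h x = 0 ∧ N.bellmanGap g' h' x = 0 ∧
      N.trans x = M.trans x} U := by
  intro hU
  obtain ⟨π, hπ, hout⟩ := hM.exists_policy hne hU
  have hπM : π ∈ M.optPolicies := fun s => (hg s).symm ▸
    M.gain_eq_of_absorbing g h hgap π U (fun s hs => ⟨(hπ s hs).1.1, (hπ s hs).2⟩)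
      (hout M (Dominates.refl M)) s
  have hπN : π ∈ N.optPolicies := fun s => (hg' s).symm ▸
    N.gain_eq_of_absorbing g' h' hgap' π U
      (fun s hs => ⟨(hπ s hs).1.2.1, (hπ s hs).1.2.2 ▸ (hπ s hs).2⟩) (hout N hN) s
  exact Set.notMem_empty π (hdisj ▸ ⟨hπN, hπM⟩)

end MDP

end MarkovDecision

namespace MarkovDecision

/-! ### Additive functionals of the history -/

section History

variable {S : Type*} {A : S → Type*} {n : ℕ}

/-- The additive functional `∑_{t ≤ n} f(X_t)` of the pairs played. -/
def total {E : Type*} [AddCommMonoid E] (f : Pair A → E) (h : History A n) : E :=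
  ∑ t, f (h.1 t).1

/-- The sum of the rewards received. -/
def sumReward (h : History A n) : ℝ := ∑ t, (h.1 t).2

/-- The history extended by one step: the pair played, its reward and the next state. -/
def History.append (z : History A n × (Pair A × (ℝ × S))) : History A (n + 1) :=
  (Fin.snoc z.1.1 (z.2.1, z.2.2.1), z.2.2.2)

theorem total_append {E : Type*} [AddCommMonoid E] (f : Pair A → E)
    (z : History A n × (Pair A × (ℝ × S))) :
    total f (History.append z) = total f z.1 + f z.2.1 := by
  simp [total, History.append, Fin.sum_univ_castSucc]

theorem sumReward_append (z : History A n × (Pair A × (ℝ × S))) :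
    sumReward (History.append z) = sumReward z.1 + z.2.2.1 := by
  simp [sumReward, History.append, Fin.sum_univ_castSucc]

theorem sum_visits_mul [Fintype (Pair A)] (f : Pair A → ℝ≥0∞) (h : History A n) :
    ∑ x, (visits h x : ℝ≥0∞) * f x = total f h := by
  classical
  rw [total, ← Finset.sum_fiberwise_of_maps_to (t := Finset.univ) (g := fun t => (h.1 t).1)
    fun _ _ => Finset.mem_univ _]
  refine Finset.sum_congr rfl fun x _ => ?_
  rw [Finset.sum_congr rfl fun t ht => congrArg f (Finset.mem_filter.1 ht).2,
    Finset.sum_const, nsmul_eq_mul, visits]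

variable [MeasurableSpace S]

theorem measurable_append :
    Measurable (History.append : History A n × (Pair A × (ℝ × S)) → History A (n + 1)) := by
  refine Measurable.prodMk (measurable_pi_lambda _ fun t => ?_) (by fun_prop)
  refine Fin.lastCases ?_ (fun i => ?_) t
  · simp only [Fin.snoc_last]
    fun_prop
  · simp only [Fin.snoc_castSucc]
    fun_prop

theorem measurable_total {E : Type*} [AddCommMonoid E] [MeasurableSpace E] [MeasurableAdd₂ E]
    (f : Pair A → E) : Measurable (total f : History A n → E) :=
  Finset.measurable_sum _ fun t _ => (Measurable.of_discrete (f := f)).comp (by fun_prop)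

theorem measurable_sumReward : Measurable (sumReward : History A n → ℝ) :=
  Finset.measurable_sum _ fun t _ => by fun_prop

end History

/-! ### Relative entropy -/

section KullbackLeibler

open InformationTheory

variable {α β : Type*} {mα : MeasurableSpace α} {mβ : MeasurableSpace β}

theorem klDiv_compProd_right_eq_lintegral [MeasurableSpace.CountableOrCountablyGenerated α β]
    (μ : Measure α) [IsFiniteMeasure μ] (κ η : Kernel α β) [IsMarkovKernel κ] [IsMarkovKernel η]
    (h : ∀ a, κ a ≪ η a) :
    klDiv (μ ⊗ₘ κ) (μ ⊗ₘ η) = ∫⁻ a, klDiv (κ a) (η a) ∂μ := by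
  have hκ : η.withDensity (κ.rnDeriv η) = κ :=
    Kernel.ext fun a => Kernel.withDensity_rnDeriv_eq (h a)
  have : IsSFiniteKernel (η.withDensity (κ.rnDeriv η)) := hκ ▸ inferInstance
  have hdens : μ ⊗ₘ κ = (μ ⊗ₘ η).withDensity fun p => κ.rnDeriv η p.1 p.2 := by
    rw [← Measure.compProd_withDensity (Kernel.measurable_rnDeriv κ η), hκ]
  have hac : μ ⊗ₘ κ ≪ μ ⊗ₘ η := hdens ▸ withDensity_absolutelyContinuous _ _
  have hrn : (μ ⊗ₘ κ).rnDeriv (μ ⊗ₘ η) =ᵐ[μ ⊗ₘ η] fun p => κ.rnDeriv η p.1 p.2 := by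
    rw [hdens]
    exact Measure.rnDeriv_withDensity _ (Kernel.measurable_rnDeriv κ η)
  have hmeas : Measurable fun p : α × β => ENNReal.ofReal (klFun (κ.rnDeriv η p.1 p.2).toReal) :=
    ENNReal.measurable_ofReal.comp
      (measurable_klFun.comp (Kernel.measurable_rnDeriv κ η).ennreal_toReal)
  rw [klDiv_eq_lintegral_klFun_of_ac hac,
    lintegral_congr_ae (hrn.mono fun p hp => by rw [hp]), Measure.lintegral_compProd hmeas]
  refine lintegral_congr fun a => ?_
  rw [klDiv_eq_lintegral_klFun_of_ac (h a)]
  exact lintegral_congr_ae ((Kernel.rnDeriv_eq_rnDeriv_measure (κ := κ) (η := η) (a := a)).mono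
    fun b hb => by simp only [hb])

theorem klDiv_prod_le (μ μ' : Measure α) (ν ν' : Measure β) [IsProbabilityMeasure μ]
    [IsProbabilityMeasure μ'] [IsProbabilityMeasure ν] [IsProbabilityMeasure ν'] :
    klDiv (μ.prod ν) (μ'.prod ν') ≤ klDiv μ μ' + klDiv ν ν' := by
  have h1 : klDiv (μ.prod ν) (μ.prod ν') ≤ klDiv ν ν' := by
    rw [← Measure.prod_swap (μ := ν) (ν := μ), ← Measure.prod_swap (μ := ν') (ν := μ)]
    refine (klDiv_map_le _ _ measurable_swap).trans ?_
    rw [← Measure.compProd_const, ← Measure.compProd_const, klDiv_compProd_left]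
  rw [← Measure.compProd_const, ← Measure.compProd_const, klDiv_compProd_eq_add,
    Measure.compProd_const, Measure.compProd_const]
  gcongr

/-- The change of measure: an event of probability `a` under `μ` and at most `b` under `ν` forces
the relative entropy to be at least `a log (a / b) - a`. -/
theorem ofReal_mul_log_le_klDiv (μ ν : Measure α) [IsProbabilityMeasure μ] [IsProbabilityMeasure ν]
    {E : Set α} (hE : MeasurableSet E) {b : ℝ} (hb : 0 < b) (hνE : ν.real E ≤ b) :
    ENNReal.ofReal (μ.real E * Real.log (μ.real E / b) - μ.real E) ≤ klDiv μ ν := by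
  by_cases hac : μ ≪ ν
  swap
  · simp [klDiv_of_not_ac hac]
  have hacE : μ.restrict E ≪ ν.restrict E := hac.restrict E
  have hrestr : klDiv (μ.restrict E) (ν.restrict E) ≤ klDiv μ ν := by
    rw [klDiv_eq_lintegral_klFun_of_ac hac, klDiv_eq_lintegral_klFun_of_ac hacE]
    have hrn : (μ.restrict E).rnDeriv (ν.restrict E) =ᵐ[ν.restrict E] μ.rnDeriv ν := by
      have : μ.restrict E = (ν.restrict E).withDensity (μ.rnDeriv ν) := by
        rw [← restrict_withDensity hE, Measure.withDensity_rnDeriv_eq _ _ hac]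
      rw [this]
      exact Measure.rnDeriv_withDensity _ (Measure.measurable_rnDeriv _ _)
    rw [lintegral_congr_ae (hrn.mono fun p hp => by rw [hp])]
    exact setLIntegral_le_lintegral _ _
  refine le_trans (ENNReal.ofReal_le_ofReal ?_)
    ((mul_log_le_klDiv (μ.restrict E) (ν.restrict E)).trans hrestr)
  simp only [measureReal_restrict_apply_univ]
  have hν0 : 0 ≤ ν.real E := measureReal_nonneg
  rcases (measureReal_nonneg (μ := μ) (s := E)).eq_or_lt with h0 | hpos
  · simp [← h0, hν0]
  have hνpos : 0 < ν.real E := by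
    refine lt_of_le_of_ne hν0 fun h => ?_
    have h1 : ν E = 0 := by
      simpa [measureReal_def, ENNReal.toReal_eq_zero_iff] using h.symm
    simp [measureReal_def, hac h1] at hpos
  have hlog : Real.log (μ.real E / b) ≤ Real.log (μ.real E / ν.real E) :=
    Real.log_le_log (div_pos hpos hb) (div_le_div_of_nonneg_left hpos.le hνpos hνE)
  have := mul_le_mul_of_nonneg_left hlog hpos.le
  linarith

end KullbackLeibler

namespace MDP

variable {S : Type*} [Fintype S] [MeasurableSpace S] [DiscreteMeasurableSpace S]
  {A : S → Type*} [∀ s, Fintype (A s)]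

/-! ### One step of the interaction -/

instance (M : MDP A) : IsMarkovKernel M.response :=
  ⟨fun x => inferInstanceAs (IsProbabilityMeasure ((M.reward x).prod (M.trans x)))⟩

theorem response_apply (M : MDP A) (x : Pair A) :
    M.response x = (M.reward x).prod (M.trans x) := rfl

/-- The kernel from the history to the pair played next, its reward and the next state. -/
noncomputable def stepKernel (M : MDP A) (L : Learner A) (n : ℕ) :
    Kernel (History A n) (Pair A × (ℝ × S)) :=
  L.play n ⊗ₖ M.response.prodMkLeft (History A n)

instance (M : MDP A) (L : Learner A) (n : ℕ) : IsMarkovKernel (M.stepKernel L n) := by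
  unfold stepKernel; infer_instance

theorem stepKernel_apply (M : MDP A) (L : Learner A) (n : ℕ) (h : History A n) :
    M.stepKernel L n h = L.play n h ⊗ₘ M.response := by
  ext E hE
  rw [stepKernel, Kernel.compProd_apply hE, Measure.compProd_apply hE]
  rfl

theorem historyLaw_succ (M : MDP A) (L : Learner A) (s₀ : S) (n : ℕ) :
    M.historyLaw L s₀ (n + 1) =
      (M.historyLaw L s₀ n ⊗ₘ M.stepKernel L n).map History.append := rfl

instance (M : MDP A) (L : Learner A) (s₀ : S) (n : ℕ) :
    IsProbabilityMeasure (M.historyLaw L s₀ n) := by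
  induction n with
  | zero => exact inferInstanceAs (IsProbabilityMeasure (Measure.dirac _))
  | succ n ih =>
    rw [historyLaw_succ]
    exact Measure.isProbabilityMeasure_map measurable_append.aemeasurable

theorem lintegral_stepLaw (M : MDP A) (L : Learner A) (s₀ : S) (n : ℕ)
    {f : History A n × (Pair A × (ℝ × S)) → ℝ≥0∞} (hf : Measurable f) :
    ∫⁻ z, f z ∂(M.historyLaw L s₀ n ⊗ₘ M.stepKernel L n) =
      ∫⁻ h, ∫⁻ x, ∫⁻ y, f (h, x, y) ∂(M.response x) ∂(L.play n h) ∂(M.historyLaw L s₀ n) := by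
  rw [Measure.lintegral_compProd hf]
  refine lintegral_congr fun h => ?_
  rw [stepKernel_apply, Measure.lintegral_compProd (by fun_prop)]

theorem lintegral_historyLaw_succ (M : MDP A) (L : Learner A) (s₀ : S) (n : ℕ)
    {f : History A (n + 1) → ℝ≥0∞} (hf : Measurable f) :
    ∫⁻ h, f h ∂(M.historyLaw L s₀ (n + 1)) =
      ∫⁻ h, ∫⁻ x, ∫⁻ y, f (History.append (h, x, y)) ∂(M.response x) ∂(L.play n h)
        ∂(M.historyLaw L s₀ n) := by
  rw [historyLaw_succ, lintegral_map hf measurable_append]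
  exact lintegral_stepLaw _ _ _ _ (hf.comp measurable_append)

theorem lintegral_total_succ (M : MDP A) (L : Learner A) (s₀ : S) (n : ℕ) (f : Pair A → ℝ≥0∞) :
    ∫⁻ h, total f h ∂(M.historyLaw L s₀ (n + 1)) =
      ∫⁻ h, total f h ∂(M.historyLaw L s₀ n) +
        ∫⁻ h, ∫⁻ x, f x ∂(L.play n h) ∂(M.historyLaw L s₀ n) := by
  rw [lintegral_historyLaw_succ _ _ _ _ (measurable_total f), ← lintegral_add_left
    (measurable_total f)]
  refine lintegral_congr fun h => ?_
  simp only [total_append, lintegral_const, measure_univ, mul_one]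
  rw [lintegral_add_left measurable_const]
  simp

/-- The relative entropy of the histories is at most the expected total of the relative entropies of
the pairs that are played. -/
theorem klDiv_historyLaw_le (M N : MDP A) (hN : N.Dominates M) (L : Learner A) (s₀ : S) (n : ℕ) :
    InformationTheory.klDiv (M.historyLaw L s₀ n) (N.historyLaw L s₀ n) ≤
      ∫⁻ h, total (M.kl N) h ∂(M.historyLaw L s₀ n) := by
  have hac (x : Pair A) : M.response x ≪ N.response x := (hN x).2.prod (hN x).1
  have hac' (n : ℕ) (h : History A n) : M.stepKernel L n h ≪ N.stepKernel L n h := by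
    rw [stepKernel_apply, stepKernel_apply]
    exact Measure.AbsolutelyContinuous.compProd_right (Eventually.of_forall hac)
  induction n with
  | zero => simp [historyLaw, InformationTheory.klDiv_self]
  | succ n ih =>
    rw [lintegral_total_succ, historyLaw_succ, historyLaw_succ]
    refine (InformationTheory.klDiv_map_le _ _ measurable_append).trans ?_
    rw [InformationTheory.klDiv_compProd_eq_add]
    refine add_le_add ih ?_
    rw [klDiv_compProd_right_eq_lintegral _ _ _ (hac' n)]
    refine lintegral_mono fun h => ?_
    rw [stepKernel_apply, stepKernel_apply, klDiv_compProd_right_eq_lintegral _ _ _ hac]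
    refine lintegral_mono fun x => ?_
    rw [response_apply, response_apply, kl, add_comm]
    exact klDiv_prod_le _ _ _ _

/-! ### Regret and suboptimal pairs -/

theorem integrable_stepLaw (M : MDP A) (L : Learner A) (s₀ : S) (n : ℕ)
    {ψ : Pair A × (ℝ × S) → ℝ} (hψ : Measurable ψ)
    (hint : ∀ x, Integrable (fun y => ψ (x, y)) (M.response x)) :
    Integrable (fun z => ψ z.2) (M.historyLaw L s₀ n ⊗ₘ M.stepKernel L n) := by
  refine ⟨(hψ.comp measurable_snd).aestronglyMeasurable, ?_⟩
  rw [HasFiniteIntegral, lintegral_stepLaw _ _ _ _ (by fun_prop)]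
  calc ∫⁻ h, ∫⁻ x, ∫⁻ y, ‖ψ (x, y)‖ₑ ∂(M.response x) ∂(L.play n h) ∂(M.historyLaw L s₀ n)
      ≤ ∫⁻ _, ∫⁻ _, ∑ x, ∫⁻ y, ‖ψ (x, y)‖ₑ ∂(M.response x) ∂(L.play n _)
          ∂(M.historyLaw L s₀ n) := by
        refine lintegral_mono fun h => lintegral_mono fun x => ?_
        exact Finset.single_le_sum (f := fun x => ∫⁻ y, ‖ψ (x, y)‖ₑ ∂(M.response x))
          (fun _ _ => bot_le) (Finset.mem_univ x)
    _ = ∑ x, ∫⁻ y, ‖ψ (x, y)‖ₑ ∂(M.response x) := by simp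
    _ < ∞ := ENNReal.sum_lt_top.2 fun x _ => (hint x).2

theorem integral_stepLaw_eq_zero (M : MDP A) (L : Learner A) (s₀ : S) (n : ℕ)
    {ψ : Pair A × (ℝ × S) → ℝ} (hψ : Measurable ψ)
    (hint : ∀ x, Integrable (fun y => ψ (x, y)) (M.response x))
    (h0 : ∀ x, ∫ y, ψ (x, y) ∂(M.response x) = 0) :
    ∫ z, ψ z.2 ∂(M.historyLaw L s₀ n ⊗ₘ M.stepKernel L n) = 0 := by
  rw [Measure.integral_compProd (M.integrable_stepLaw L s₀ n hψ hint)]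
  refine integral_eq_zero_of_ae (Eventually.of_forall fun h => ?_)
  have hint' : Integrable ψ (L.play n h ⊗ₘ M.response) :=
    (Measure.integrable_compProd_iff hψ.aestronglyMeasurable).2
      ⟨Eventually.of_forall hint, Integrable.of_finite⟩
  simp only [stepKernel_apply, Measure.integral_compProd hint', h0, integral_zero, Pi.zero_apply]

theorem map_fst_stepLaw (M : MDP A) (L : Learner A) (s₀ : S) (n : ℕ) :
    (M.historyLaw L s₀ n ⊗ₘ M.stepKernel L n).map Prod.fst = M.historyLaw L s₀ n :=
  Measure.fst_compProd _ _

theorem ae_stepLaw_state_eq (M : MDP A) (L : Learner A) (s₀ : S) (n : ℕ) :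
    ∀ᵐ z ∂(M.historyLaw L s₀ n ⊗ₘ M.stepKernel L n), z.2.1.state = z.1.2 := by
  have hstate : Measurable (Pair.state : Pair A → S) := .of_discrete
  rw [Measure.ae_compProd_iff (measurableSet_eq_fun (by fun_prop) (by fun_prop))]
  refine Eventually.of_forall fun h => ?_
  rw [stepKernel_apply,
    Measure.ae_compProd_iff (measurableSet_eq_fun (by fun_prop) (by fun_prop))]
  exact (L.play_current n h).mono fun x hx => Eventually.of_forall fun _ => hx

theorem integrable_reward_response (M : MDP A) (x : Pair A) :
    Integrable (fun y : ℝ × S => y.1) (M.response x) :=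
  (M.integrable_reward x).comp_fst _

theorem integrable_sumReward (M : MDP A) (L : Learner A) (s₀ : S) (n : ℕ) :
    Integrable sumReward (M.historyLaw L s₀ n) := by
  induction n with
  | zero =>
    have : (sumReward : History A 0 → ℝ) = fun _ => 0 := funext fun _ => by simp [sumReward]
    rw [this]
    exact integrable_zero _ _ _
  | succ n ih =>
    rw [historyLaw_succ, integrable_map_measure measurable_sumReward.aestronglyMeasurable
      measurable_append.aemeasurable]
    have h1 : Integrable (fun z => sumReward z.1) (M.historyLaw L s₀ n ⊗ₘ M.stepKernel L n) := by
      rw [← M.map_fst_stepLaw L s₀ n] at ih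
      exact ih.comp_measurable measurable_fst
    refine (h1.add (M.integrable_stepLaw L s₀ n (ψ := fun w => w.2.1) (by fun_prop)
      M.integrable_reward_response)).congr (Eventually.of_forall fun z => ?_)
    simp [sumReward_append]

theorem abs_total_le {C : ℝ} (f : Pair A → ℝ) (hf : ∀ x, |f x| ≤ C) {n : ℕ} (h : History A n) :
    |total f h| ≤ n * C :=
  calc |total f h| ≤ ∑ t, |f (h.1 t).1| := Finset.abs_sum_le_sum_abs _ _
    _ ≤ ∑ _t : Fin n, C := Finset.sum_le_sum fun _ _ => hf _
    _ = n * C := by simp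

theorem integrable_total (M : MDP A) (L : Learner A) (s₀ : S) (n : ℕ) (f : Pair A → ℝ) :
    Integrable (total f) (M.historyLaw L s₀ n) := by
  obtain ⟨C, -, hC⟩ := exists_forall_abs_le f
  exact Integrable.of_bound (measurable_total f).aestronglyMeasurable (n * C)
    (Eventually.of_forall fun h => abs_total_le f hC h)

theorem integrable_currentState (M : MDP A) (L : Learner A) (s₀ : S) (n : ℕ) (v : S → ℝ) :
    Integrable (fun h => v h.2) (M.historyLaw L s₀ n) := by
  obtain ⟨C, -, hC⟩ := exists_forall_abs_le v
  exact Integrable.of_bound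
    ((Measurable.of_discrete (f := v)).comp measurable_snd).aestronglyMeasurable C
    (Eventually.of_forall fun h => hC h.2)

/-- In each step, the reward plus the gap plus the increment of `v` has mean `g`. -/
theorem integral_sumReward_add_total_gap (M : MDP A) (L : Learner A) (s₀ : S) (g : ℝ) (v : S → ℝ)
    (n : ℕ) :
    ∫ h, (sumReward h + total (M.bellmanGap g v) h + v h.2) ∂(M.historyLaw L s₀ n) =
      n * g + v s₀ := by
  induction n with
  | zero => simp [historyLaw, sumReward, total]
  | succ n ih =>
    have hv : Measurable v := .of_discrete
    have hgap : Measurable (M.bellmanGap g v) := .of_discrete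
    have hst : Measurable (fun x : Pair A => v x.state) := .of_discrete
    let ψ : Pair A × (ℝ × S) → ℝ := fun w =>
      w.2.1 + v w.2.2 + (M.bellmanGap g v w.1 - v w.1.state - g)
    have hψ : Measurable ψ := by fun_prop
    have hintv (x : Pair A) : Integrable (fun y : ℝ × S => v y.2) (M.response x) :=
      (Integrable.of_finite (μ := M.trans x)).comp_snd _
    have hint (x : Pair A) : Integrable (fun y => ψ (x, y)) (M.response x) :=
      ((M.integrable_reward_response x).add (hintv x)).add
        (integrable_const (M.bellmanGap g v x - v x.state - g))
    have h0 (x : Pair A) : ∫ y, ψ (x, y) ∂(M.response x) = 0 := by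
      simp only [ψ]
      have hsum : Integrable (fun y : ℝ × S => y.1 + v y.2) (M.response x) :=
        (M.integrable_reward_response x).add (hintv x)
      rw [integral_add hsum
          (integrable_const (M.bellmanGap g v x - v x.state - g)),
        integral_add (M.integrable_reward_response x) (hintv x), response_apply,
        integral_fun_fst (fun r : ℝ => r), integral_fun_snd v]
      simp [bellmanGap, meanReward]
      ring
    let φ : {m : ℕ} → History A m → ℝ := fun h =>
      sumReward h + total (M.bellmanGap g v) h + v h.2
    have hφ (m : ℕ) : Measurable (φ : History A m → ℝ) :=
      (measurable_sumReward.add (measurable_total _)).add (hv.comp measurable_snd)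
    have hφint : Integrable φ (M.historyLaw L s₀ n) :=
      ((M.integrable_sumReward L s₀ n).add (M.integrable_total L s₀ n _)).add
        (M.integrable_currentState L s₀ n v)
    have hae : (fun z : History A n × (Pair A × (ℝ × S)) => φ (History.append z)) =ᵐ[
          M.historyLaw L s₀ n ⊗ₘ M.stepKernel L n] fun z => (φ z.1 + ψ z.2) + g := by
      filter_upwards [M.ae_stepLaw_state_eq L s₀ n] with z hz
      have hnext : (History.append z).2 = z.2.2.2 := rfl
      simp only [φ, sumReward_append, total_append, ψ, hz, hnext]
      ring
    have hint₁ : Integrable (fun z => φ z.1) (M.historyLaw L s₀ n ⊗ₘ M.stepKernel L n) := by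
      rw [← M.map_fst_stepLaw L s₀ n] at hφint
      exact hφint.comp_measurable measurable_fst
    have hint₂ : Integrable (fun z => φ z.1 + ψ z.2)
        (M.historyLaw L s₀ n ⊗ₘ M.stepKernel L n) :=
      hint₁.add (M.integrable_stepLaw L s₀ n hψ hint)
    have ih' : ∫ z, φ z.1 ∂(M.historyLaw L s₀ n ⊗ₘ M.stepKernel L n) = n * g + v s₀ := by
      rw [← M.map_fst_stepLaw L s₀ n, integral_map measurable_fst.aemeasurable
        (hφ n).aestronglyMeasurable] at ih
      exact ih
    change ∫ h, φ h ∂(M.historyLaw L s₀ (n + 1)) = _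
    rw [historyLaw_succ, integral_map measurable_append.aemeasurable
        (hφ (n + 1)).aestronglyMeasurable,
      integral_congr_ae hae, integral_add hint₂ (integrable_const g),
      integral_add hint₁ (M.integrable_stepLaw L s₀ n hψ hint),
      M.integral_stepLaw_eq_zero L s₀ n hψ hint h0, ih']
    simp
    ring

/-- The number of steps in which a pair outside of `Z` is played. -/
noncomputable def timeOutside (Z : Set (Pair A)) {n : ℕ} (h : History A n) : ℝ :=
  total (Zᶜ.indicator 1) h

theorem measurable_timeOutside (Z : Set (Pair A)) (n : ℕ) :
    Measurable (timeOutside Z : History A n → ℝ) := measurable_total _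

/-- Since the expected regret is, up to a bounded term, the expected total gap, a learner with
subpolynomial regret plays pairs with positive gap only for a subpolynomial time. -/
theorem eventually_integral_timeOutside_le (M : MDP A) (L : Learner A) (s₀ : S) (g : ℝ) (v : S → ℝ)
    (hg : M.optGain s₀ = g) (hgap : ∀ x, 0 ≤ M.bellmanGap g v x) {η : ℝ} (hη : 0 < η)
    (hL : (fun T : ℕ => M.regret L s₀ T) =o[atTop] (fun T : ℕ => (T : ℝ) ^ η)) :
    ∀ᶠ T : ℕ in atTop,
      ∫ h, timeOutside {x | M.bellmanGap g v x = 0} h ∂(M.historyLaw L s₀ T) ≤ (T : ℝ) ^ η := by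
  obtain ⟨δ, hδ, hδle⟩ := exists_pos_forall_le_of_ne_zero _ hgap
  obtain ⟨B, hB0, hB⟩ := exists_forall_abs_le v
  have hconst : (fun _ : ℕ => 2 * B) =o[atTop] (fun T : ℕ => (T : ℝ) ^ η) :=
    isLittleO_const_left.2 (Or.inr (tendsto_norm_atTop_atTop.comp
      ((tendsto_rpow_atTop hη).comp tendsto_natCast_atTop_atTop)))
  filter_upwards [(hL.add hconst).bound hδ] with T hT
  rw [Real.norm_of_nonneg (Real.rpow_nonneg T.cast_nonneg η)] at hT
  have h1 : δ * ∫ h, timeOutside {x | M.bellmanGap g v x = 0} h ∂(M.historyLaw L s₀ T) ≤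
      ∫ h, total (M.bellmanGap g v) h ∂(M.historyLaw L s₀ T) := by
    rw [← integral_const_mul]
    refine integral_mono ((M.integrable_total L s₀ T _).const_mul δ)
      (M.integrable_total L s₀ T _) fun h => ?_
    simp only [timeOutside, total, Finset.mul_sum]
    refine Finset.sum_le_sum fun t _ => ?_
    by_cases hx : M.bellmanGap g v (h.1 t).1 = 0
    · simp [hx]
    · simpa [hx] using hδle _ hx
  have h2 := M.integral_sumReward_add_total_gap L s₀ g v T
  have hint : Integrable (fun h => sumReward h + total (M.bellmanGap g v) h)
      (M.historyLaw L s₀ T) := (M.integrable_sumReward L s₀ T).add (M.integrable_total L s₀ T _)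
  rw [integral_add hint (M.integrable_currentState L s₀ T v),
    integral_add (M.integrable_sumReward L s₀ T) (M.integrable_total L s₀ T _)] at h2
  have h3 : |∫ h, v h.2 ∂(M.historyLaw L s₀ T)| ≤ B := by
    simpa using norm_integral_le_of_norm_le_const (μ := M.historyLaw L s₀ T)
      (f := fun h : History A T => v h.2) (C := B) (Eventually.of_forall fun h => hB h.2)
  have h4 : M.regret L s₀ T = T * g - ∫ h, sumReward h ∂(M.historyLaw L s₀ T) := by
    rw [regret, hg]; rfl
  have h5 := (le_abs_self _).trans hT
  have h6 := (abs_le.1 h3).1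
  have h7 := (abs_le.1 (hB s₀)).2
  refine le_of_mul_le_mul_left (h1.trans ?_) hδ
  linarith

/-- If no set of states is closed under pairs of `Z`, then a linear number of pairs outside of `Z` is
played, with probability tending to one: `exp (∑ w(X_t)) V(S_t)` is a supermartingale, where `V` is
the potential and the weight `w` is a positive constant on `Z`. -/
theorem exists_tendsto_timeOutside (M : MDP A) (L : Learner A) (s₀ : S) (Z : Set (Pair A))
    (hZ : ∀ U : Set S, U.Nonempty → ¬ M.Absorbing Z U) :
    ∃ c : ℝ, 0 < c ∧ Tendsto (fun T : ℕ =>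
      (M.historyLaw L s₀ T).real {h | timeOutside Z h ≤ c * T}) atTop (𝓝 0) := by
  classical
  obtain ⟨V, hV1, hV⟩ := M.exists_potential_of_not_absorbing Z hZ
  obtain ⟨B₀, hB₀, hVB₀⟩ := exists_forall_abs_le V
  set B : ℝ := B₀ + 1 with hB
  have hVB (s : S) : V s ≤ B := by linarith [(abs_le.1 (hVB₀ s)).2]
  have hBpos : 0 < B := by positivity
  have hB1 : 1 ≤ B := by linarith
  have hV0 (s : S) : 0 ≤ V s := zero_le_one.trans (hV1 s)
  set θ : ℝ := 1 / B with hθ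
  have hθpos : 0 < θ := by positivity
  set κ : ℝ := θ + Real.log B with hκ
  have hκpos : 0 < κ := by linarith [Real.log_nonneg hB1]
  set w : Pair A → ℝ := fun x => θ - κ * Zᶜ.indicator 1 x with hw
  have hstep (x : Pair A) : Real.exp (w x) * ∫ s', V s' ∂(M.trans x) ≤ V x.state := by
    by_cases hx : x ∈ Z
    · have h1 := hV x hx
      have h2 : (1 - θ) * V x.state ≥ V x.state - 1 := by
        have : θ * V x.state ≤ 1 := by
          rw [hθ, one_div, inv_mul_le_iff₀ hBpos]; linarith [hVB x.state]
        linarith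
      have h3 : 1 - θ ≤ Real.exp (-θ) := by linarith [Real.add_one_le_exp (-θ)]
      have h4 : ∫ s', V s' ∂(M.trans x) ≤ Real.exp (-θ) * V x.state := by
        nlinarith [hV0 x.state]
      have h5 : w x = θ := by simp [hw, hx]
      rw [h5]
      calc _ ≤ Real.exp θ * (Real.exp (-θ) * V x.state) := by gcongr
        _ = V x.state := by rw [← mul_assoc, ← Real.exp_add]; simp
    · have h1 : ∫ s', V s' ∂(M.trans x) ≤ B := by
        have := integral_mono (μ := M.trans x) Integrable.of_finite Integrable.of_finite hVB
        simpa using this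
      have h5 : w x = -Real.log B := by simp [hw, hx, hκ]
      rw [h5, Real.exp_neg, Real.exp_log hBpos, inv_mul_le_iff₀ hBpos]
      nlinarith [hV1 x.state]
  have hmeasF (n : ℕ) : Measurable fun h : History A n =>
      ENNReal.ofReal (Real.exp (total w h) * V h.2) :=
    ENNReal.measurable_ofReal.comp ((Real.measurable_exp.comp (measurable_total w)).mul
      ((Measurable.of_discrete (f := V)).comp measurable_snd))
  have hsuper (n : ℕ) : ∫⁻ h, ENNReal.ofReal (Real.exp (total w h) * V h.2)
      ∂(M.historyLaw L s₀ n) ≤ ENNReal.ofReal (V s₀) := by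
    induction n with
    | zero =>
      rw [historyLaw, lintegral_dirac' _ (hmeasF 0)]
      simp [total]
    | succ n ih =>
      rw [lintegral_historyLaw_succ _ _ _ _ (hmeasF (n + 1))]
      refine le_trans (lintegral_mono fun h => ?_) ih
      calc _ ≤ ∫⁻ _, ENNReal.ofReal (Real.exp (total w h) * V h.2) ∂(L.play n h) := by
            refine lintegral_mono_ae ((L.play_current n h).mono fun x hx => ?_)
            have hy : ∀ y : ℝ × S, ENNReal.ofReal (Real.exp (total w (History.append (h, x, y))) *
                V (History.append (h, x, y)).2) =
                ENNReal.ofReal (Real.exp (total w h) * Real.exp (w x)) * ENNReal.ofReal (V y.2) :=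
              fun y => by
                rw [total_append, Real.exp_add, ENNReal.ofReal_mul (by positivity)]
                rfl
            have hVm : Measurable fun y : ℝ × S => ENNReal.ofReal (V y.2) :=
              (Measurable.of_discrete (f := fun s => ENNReal.ofReal (V s))).comp measurable_snd
            simp only [hy]
            rw [lintegral_const_mul _ hVm, response_apply, lintegral_prod _ hVm.aemeasurable]
            simp only [lintegral_const, measure_univ, mul_one]
            rw [← ofReal_integral_eq_lintegral_ofReal Integrable.of_finite
              (Eventually.of_forall hV0), ← ENNReal.ofReal_mul (by positivity), mul_assoc]
            refine ENNReal.ofReal_le_ofReal ?_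
            rw [← hx]
            gcongr
            exact hstep x
        _ = _ := by simp
  refine ⟨θ / (2 * κ), by positivity, ?_⟩
  have hbound (n : ℕ) : (M.historyLaw L s₀ n).real {h | timeOutside Z h ≤ θ / (2 * κ) * n} ≤
      V s₀ * Real.exp (-(θ / 2)) ^ n := by
    have hsub : {h : History A n | timeOutside Z h ≤ θ / (2 * κ) * n} ⊆
        {h | ENNReal.ofReal (Real.exp (θ / 2 * n)) ≤
          ENNReal.ofReal (Real.exp (total w h) * V h.2)} := by
      intro h hh
      have h1 : total w h = θ * n - κ * timeOutside Z h := by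
        simp [hw, timeOutside, total, Finset.sum_sub_distrib, Finset.mul_sum, mul_comm]
      have h2 : κ * timeOutside Z h ≤ θ / 2 * n := by
        calc κ * timeOutside Z h ≤ κ * (θ / (2 * κ) * n) := by gcongr; exact hh
          _ = θ / 2 * n := by field_simp
      refine ENNReal.ofReal_le_ofReal ?_
      calc Real.exp (θ / 2 * n) ≤ Real.exp (total w h) := Real.exp_le_exp.2 (by rw [h1]; linarith)
        _ ≤ Real.exp (total w h) * V h.2 :=
          le_mul_of_one_le_right (Real.exp_pos _).le (hV1 _)
    have h1 := (mul_le_mul_right (measure_mono (μ := M.historyLaw L s₀ n) hsub)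
      (ENNReal.ofReal (Real.exp (θ / 2 * n)))).trans
      ((mul_meas_ge_le_lintegral (hmeasF n) _).trans (hsuper n))
    have h2 := ENNReal.toReal_mono ENNReal.ofReal_ne_top h1
    rw [ENNReal.toReal_mul, ENNReal.toReal_ofReal (Real.exp_pos _).le,
      ENNReal.toReal_ofReal (hV0 s₀)] at h2
    rw [← Real.exp_nat_mul, measureReal_def]
    have h3 : (n : ℝ) * -(θ / 2) = -(θ / 2 * n) := by ring
    rw [h3, Real.exp_neg, ← div_eq_mul_inv, le_div_iff₀ (Real.exp_pos _), mul_comm]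
    exact h2
  refine squeeze_zero (fun _ => measureReal_nonneg) hbound ?_
  simpa using (tendsto_pow_atTop_nhds_zero_of_lt_one (Real.exp_pos _).le
    (Real.exp_lt_one_iff.2 (by linarith : -(θ / 2) < 0))).const_mul (V s₀)

end MDP

end MarkovDecision

namespace MarkovDecision

namespace MDP

variable {S : Type*} [Fintype S] [MeasurableSpace S] [DiscreteMeasurableSpace S]
  {A : S → Type*} [∀ s, Fintype (A s)]

/-! ### The lower bound -/

theorem indicator_one_nonneg (Z : Set (Pair A)) (x : Pair A) :
    0 ≤ Z.indicator (1 : Pair A → ℝ) x :=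
  Set.indicator_nonneg (fun _ _ => zero_le_one) x

theorem timeOutside_nonneg (Z : Set (Pair A)) {n : ℕ} (h : History A n) : 0 ≤ timeOutside Z h := by
  unfold timeOutside total
  exact Finset.sum_nonneg fun _ _ => indicator_one_nonneg _ _

theorem integrable_timeOutside (M : MDP A) (L : Learner A) (s₀ : S) (n : ℕ) (Z : Set (Pair A)) :
    Integrable (timeOutside Z) (M.historyLaw L s₀ n) := M.integrable_total L s₀ n _

theorem timeOutside_inter_le (Z Z' : Set (Pair A)) {n : ℕ} (h : History A n) :
    timeOutside (Z ∩ Z') h ≤ timeOutside Z h + timeOutside Z' h := by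
  classical
  simp only [timeOutside, total, ← Finset.sum_add_distrib]
  refine Finset.sum_le_sum fun t _ => ?_
  by_cases h1 : (h.1 t).1 ∈ Z <;> by_cases h2 : (h.1 t).1 ∈ Z' <;> simp [h1, h2]

theorem measureReal_le_timeOutside_le (M : MDP A) (L : Learner A) (s₀ : S) (n : ℕ)
    (Z : Set (Pair A)) {u C : ℝ} (hu : 0 < u)
    (hC : ∫ h, timeOutside Z h ∂(M.historyLaw L s₀ n) ≤ C) :
    (M.historyLaw L s₀ n).real {h | u ≤ timeOutside Z h} ≤ C / u := by
  rw [le_div_iff₀ hu, mul_comm]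
  exact (mul_meas_ge_le_integral_of_nonneg (Eventually.of_forall (timeOutside_nonneg Z))
    (M.integrable_timeOutside L s₀ n Z) u).trans hC

/-- Playing pairs on which the two models differ accumulates information at a positive rate. -/
theorem exists_integral_timeOutside_le_lintegral_kl (M N : MDP A) (L : Learner A) (s₀ : S) :
    ∃ p : ℝ, 0 < p ∧ ∀ (n : ℕ) (C : ℝ), 0 ≤ C →
      ∫⁻ h, total (M.kl N) h ∂(M.historyLaw L s₀ n) ≤ ENNReal.ofReal C →
      ∫ h, timeOutside {x | N.trans x = M.trans x} h ∂(M.historyLaw L s₀ n) ≤ C / p := by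
  classical
  obtain ⟨p, hp, hple⟩ := exists_pos_forall_le_of_ne_zero
    (fun x => (min (M.kl N x) 1).toReal) fun _ => ENNReal.toReal_nonneg
  have hkl (x : Pair A) (hx : N.trans x ≠ M.trans x) : ENNReal.ofReal p ≤ M.kl N x := by
    have h1 : M.kl N x ≠ 0 := fun h =>
      hx ((InformationTheory.klDiv_eq_zero_iff.1 (add_eq_zero.1 h).1).symm)
    have h2 : min (M.kl N x) 1 ≠ ∞ := ne_top_of_le_ne_top ENNReal.one_ne_top (min_le_right _ _)
    have h3 : min (M.kl N x) 1 ≠ 0 := fun h => by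
      rcases min_choice (M.kl N x) 1 with h' | h' <;> simp_all
    exact (ENNReal.ofReal_le_of_le_toReal (hple x (ENNReal.toReal_ne_zero.2 ⟨h3, h2⟩))).trans
      (min_le_left _ _)
  refine ⟨p, hp, fun n C hC hle => ?_⟩
  rw [le_div_iff₀ hp, mul_comm, ← integral_const_mul]
  refine (ENNReal.ofReal_le_ofReal_iff hC).1 (le_trans ?_ hle)
  rw [ofReal_integral_eq_lintegral_ofReal ((M.integrable_timeOutside L s₀ n _).const_mul p)
    (Eventually.of_forall fun h => mul_nonneg hp.le (timeOutside_nonneg _ h))]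
  refine lintegral_mono fun h => ?_
  simp only [timeOutside, total, Finset.mul_sum]
  rw [ENNReal.ofReal_sum_of_nonneg fun t _ => mul_nonneg hp.le
    (indicator_one_nonneg _ _)]
  refine Finset.sum_le_sum fun t _ => ?_
  by_cases hx : N.trans (h.1 t).1 = M.trans (h.1 t).1
  · simp [hx]
  · simpa [hx] using hkl _ hx

theorem tendsto_rpow_half_div (u : ℝ) :
    Tendsto (fun T : ℕ => (T : ℝ) ^ (1 / 2 : ℝ) / (u * T)) atTop (𝓝 0) := by
  have h1 : Tendsto (fun T : ℕ => u⁻¹ * (T : ℝ) ^ (-(1 / 2) : ℝ)) atTop (𝓝 (u⁻¹ * 0)) :=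
    ((tendsto_rpow_neg_atTop (by norm_num : (0 : ℝ) < 1 / 2)).comp
      tendsto_natCast_atTop_atTop).const_mul _
  rw [mul_zero] at h1
  refine h1.congr' ?_
  filter_upwards [eventually_gt_atTop 0] with T hT
  have hT' : (0 : ℝ) < T := Nat.cast_pos.2 hT
  have : (-(1 / 2) : ℝ) = 1 / 2 - 1 := by norm_num
  rw [this, Real.rpow_sub_one hT'.ne', mul_comm u, ← div_div, inv_mul_eq_div]

theorem tendsto_log_div (p u : ℝ) :
    Tendsto (fun T : ℕ => Real.log T / p / (u * T)) atTop (𝓝 0) := by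
  have h1 : Tendsto (fun T : ℕ => (p * u)⁻¹ * (Real.log T / T)) atTop (𝓝 ((p * u)⁻¹ * 0)) :=
    ((Real.isLittleO_log_id_atTop.tendsto_div_nhds_zero).comp
      tendsto_natCast_atTop_atTop).const_mul _
  rw [mul_zero] at h1
  refine h1.congr fun T => ?_
  rw [div_div, inv_mul_eq_div, div_div]
  congr 1
  ring

/-- The lower bound, up to an arbitrarily small factor. If the information were less than `log T`,
then under `M` a linear number of pairs that are suboptimal in `N` would be played with probability
close to one, whereas under `N` this has probability at most of order `T ^ (η - 1)`. -/
theorem eventually_mul_log_le [∀ s, Nonempty (A s)] {𝓜 : Set (MDP A)} {M N : MDP A} (hM : M ∈ 𝓜)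
    (hcomm : M.IsCommunicating) (hN : N ∈ confusing 𝓜 M) (L : Learner A) (hL : L.IsConsistent 𝓜)
    (s₀ : S) {δ : ℝ} (hδ : 0 < δ) (hδ1 : δ < 1) :
    ∀ᶠ T : ℕ in atTop, ENNReal.ofReal ((1 - δ) * Real.log T) ≤
      ∫⁻ h, total (M.kl N) h ∂(M.historyLaw L s₀ T) := by
  obtain ⟨hN𝓜, hdom, -, hdisj⟩ := hN
  have : Nonempty S := ⟨s₀⟩
  obtain ⟨g, v, hg, hgap⟩ := hcomm.exists_bellman
  obtain ⟨g', v', hg', hgap'⟩ := (hcomm.of_dominates hdom).exists_bellman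
  set WM : Set (Pair A) := {x | M.bellmanGap g v x = 0} with hWM
  set WN : Set (Pair A) := {x | N.bellmanGap g' v' x = 0} with hWN
  set D : Set (Pair A) := {x | N.trans x = M.trans x} with hD
  obtain ⟨c, hc, hlim⟩ := M.exists_tendsto_timeOutside L s₀ (WM ∩ (WN ∩ D)) fun U hne =>
    hcomm.not_absorbing_of_disjoint hdom hdisj hg hg' hgap hgap' hne
  obtain ⟨p, hp, hinfo⟩ := M.exists_integral_timeOutside_le_lintegral_kl N L s₀
  set u : ℝ := c / 3 with hu
  have hupos : 0 < u := by positivity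
  have hrest : Tendsto (fun T : ℕ =>
      (M.historyLaw L s₀ T).real {h | timeOutside (WM ∩ (WN ∩ D)) h ≤ c * T} +
        (T : ℝ) ^ (1 / 2 : ℝ) / (u * T) + Real.log T / p / (u * T)) atTop (𝓝 0) := by
    simpa using (hlim.add (tendsto_rpow_half_div u)).add (tendsto_log_div p u)
  have hlog : Tendsto (fun T : ℕ => Real.log T) atTop atTop :=
    Real.tendsto_log_atTop.comp tendsto_natCast_atTop_atTop
  filter_upwards [hrest.eventually_lt_const (by positivity : (0 : ℝ) < δ / 4),
    M.eventually_integral_timeOutside_le L s₀ g v (hg s₀) hgap one_half_pos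
      (hL M hM s₀ _ one_half_pos),
    N.eventually_integral_timeOutside_le L s₀ g' v' (hg' s₀) hgap' (by positivity : 0 < δ / 4)
      (hL N hN𝓜 s₀ _ (by positivity)),
    hlog.eventually_ge_atTop ((|Real.log u| + 1) / (δ / 2)), eventually_gt_atTop 0]
    with T hsmall hMT hNT hT hT0
  have hTpos : (0 : ℝ) < T := Nat.cast_pos.2 hT0
  have hlogT : 0 ≤ Real.log T := Real.log_nonneg (by exact_mod_cast hT0)
  rcases le_total (ENNReal.ofReal (Real.log T))
    (∫⁻ h, total (M.kl N) h ∂(M.historyLaw L s₀ T)) with hbig | hinfoT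
  · exact (ENNReal.ofReal_le_ofReal (mul_le_of_le_one_left hlogT (by linarith))).trans hbig
  have huT : 0 < u * T := mul_pos hupos hTpos
  set E : Set (History A T) := {h | u * T ≤ timeOutside WN h} with hE
  have hEmeas : MeasurableSet E := measurableSet_le measurable_const (measurable_timeOutside _ _)
  set a : ℝ := (M.historyLaw L s₀ T).real E with ha
  have ha1 : 1 - δ / 4 ≤ a := by
    have hcover : Eᶜ ⊆ {h | timeOutside (WM ∩ (WN ∩ D)) h ≤ c * T} ∪
        {h | u * T ≤ timeOutside WM h} ∪ {h | u * T ≤ timeOutside D h} := by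
      intro h hh
      by_contra hno
      simp only [Set.mem_union, Set.mem_ofPred_eq, not_or, not_le, hE, Set.mem_compl_iff] at hno hh
      have h1 := timeOutside_inter_le WM (WN ∩ D) h
      have h2 := timeOutside_inter_le WN D h
      have h3 : c * T = u * T + u * T + u * T := by rw [hu]; ring
      linarith [hno.1.1, hno.1.2, hno.2]
    -- Hence `1 - a` is at most the sum of three probabilities that tend to zero.
    have h1 := (measureReal_mono (μ := M.historyLaw L s₀ T) hcover).trans
      ((measureReal_union_le _ _).trans (add_le_add_left (measureReal_union_le _ _) _))
    have h2 := M.measureReal_le_timeOutside_le L s₀ T WM huT hMT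
    have h3 := M.measureReal_le_timeOutside_le L s₀ T D huT (hinfo T _ hlogT hinfoT)
    rw [probReal_compl_eq_one_sub hEmeas] at h1
    linarith
  have ha0 : 0 < a := by linarith
  have hb : 0 < (T : ℝ) ^ (δ / 4) / (u * T) := by positivity
  refine le_trans (ENNReal.ofReal_le_ofReal ?_) ((ofReal_mul_log_le_klDiv _ _ hEmeas hb
    (N.measureReal_le_timeOutside_le L s₀ T WN huT hNT)).trans
      (M.klDiv_historyLaw_le N hdom L s₀ T))
  have hlogb : Real.log (a / ((T : ℝ) ^ (δ / 4) / (u * T))) =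
      Real.log a + ((1 - δ / 4) * Real.log T + Real.log u) := by
    rw [Real.log_div ha0.ne' hb.ne', Real.log_div (by positivity) huT.ne',
      Real.log_mul hupos.ne' hTpos.ne', Real.log_rpow hTpos]
    ring
  have ha2 : a ≤ 1 := measureReal_le_one
  -- `a log a` is bounded below, so that only `-a log b` matters.
  have hent : a - 1 ≤ a * Real.log a := by
    have := mul_le_mul_of_nonneg_left (Real.one_sub_inv_le_log_of_pos ha0) ha0.le
    rwa [mul_sub, mul_one, mul_inv_cancel₀ ha0.ne'] at this
  have hlogu : -|Real.log u| ≤ a * Real.log u := by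
    have h1 : |a * Real.log u| ≤ |Real.log u| := by
      rw [abs_mul, abs_of_pos ha0]
      exact mul_le_of_le_one_left (abs_nonneg _) ha2
    exact (neg_le_neg h1).trans (neg_abs_le _)
  have hmain : (1 - δ / 2) * Real.log T ≤ a * ((1 - δ / 4) * Real.log T) := by
    rw [← mul_assoc]
    refine mul_le_mul_of_nonneg_right ?_ hlogT
    nlinarith
  have hT' : |Real.log u| + 1 ≤ δ / 2 * Real.log T := by
    rwa [div_le_iff₀ (by positivity), mul_comm] at hT
  rw [← ha, hlogb]
  linarith

end MDP

end MarkovDecision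

theorem mainTheorem5 {S : Type*} [Fintype S] [MeasurableSpace S] [DiscreteMeasurableSpace S]
    {A : S → Type*} [∀ s, Fintype (A s)] [∀ s, Nonempty (A s)]
    (𝓜 : Set (MarkovDecision.MDP A)) (M : MarkovDecision.MDP A) (hM : M ∈ 𝓜)
    (hcomm : M.IsCommunicating)
    (N : MarkovDecision.MDP A) (hN : N ∈ MarkovDecision.MDP.confusing 𝓜 M)
    (L : MarkovDecision.Learner A) (hL : L.IsConsistent 𝓜) (s₀ : S) :
    ∃ ε : ℕ → ℝ, ε =o[atTop] (fun T : ℕ => Real.log T) ∧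
      ∀ T : ℕ, ENNReal.ofReal (Real.log T + ε T) ≤
        ∫⁻ h, ∑ x, (MarkovDecision.visits h x : ℝ≥0∞) * M.kl N x ∂(M.historyLaw L s₀ T) := by
  classical
  simp only [MarkovDecision.sum_visits_mul]
  set F : ℕ → ℝ≥0∞ := fun T => ∫⁻ h, MarkovDecision.total (M.kl N) h ∂(M.historyLaw L s₀ T) with hF
  -- The shortfall below `log T`; `F T = ∞` is set apart because `toReal` sends it to `0`.
  refine ⟨fun T => if F T = ∞ then 0 else min 0 ((F T).toReal - Real.log T), ?_, fun T => ?_⟩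
  · refine isLittleO_iff.2 fun δ hδ => ?_
    have hδ' : 0 < min δ (1 / 2) := lt_min hδ one_half_pos
    filter_upwards [MarkovDecision.MDP.eventually_mul_log_le hM hcomm hN L hL s₀ hδ'
      ((min_le_right _ _).trans_lt one_half_lt_one), eventually_gt_atTop 0] with T hT hT0
    have hlogT : 0 ≤ Real.log T := Real.log_nonneg (by exact_mod_cast hT0)
    rw [Real.norm_of_nonneg hlogT]
    split_ifs with htop
    · simpa using mul_nonneg hδ.le hlogT
    · have h1 := (ENNReal.ofReal_le_iff_le_toReal htop).1 hT
      have h2 := mul_le_mul_of_nonneg_right (min_le_left δ (1 / 2)) hlogT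
      have h3 := mul_nonneg hδ.le hlogT
      rw [Real.norm_eq_abs, abs_of_nonpos (min_le_left _ _)]
      refine neg_le.1 (le_min (by linarith) ?_)
      linarith
  · change _ ≤ F T
    beta_reduce
    split_ifs with htop
    · simp [htop]
    · refine ENNReal.ofReal_le_of_le_toReal ?_
      linarith [min_le_right 0 ((F T).toReal - Real.log T)]
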